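/- Notation. Let $\mathcal P_1(\mathbb R)$ be the set of probability measures on $\mathbb R$ with finite first moment, and $m(\eta)=\int y\,\eta(dy)$. For $\mu,\nu\in\mathcal P_1(\mathbb R)$, $\Pi(\mu,\nu)$ is the set of couplings of $\mu$ and $\nu$; $(\pi_x)_{x\in\mathbb R}$ is the disintegration of $\pi\in\Pi(\mu,\nu)$ with respect to its first marginal, $\pi(dx,dy)=\mu(dx)\,\pi_x(dy)$; $\Pi^{\mathrm M}(\mu,\nu)$ is the set of $M\in\Pi(\mu,\nu)$ with $m(M_x)=x$ for $\mu$-a.e. $x$. Put $\mathcal W_1(\eta,\eta')=\inf_{\gamma\in\Pi(\eta,\eta')}\int|x-y|\,\gamma(dx,dy)$ and, for couplings $\pi,\pi'$ with first marginals $\mu,\mu'$, $$\mathcal{AW}_1(\pi,\pi')=\inf_{\chi\in\Pi(\mu,\mu')}\int\big(|x-x'|+\mathcal W_1(\pi_x,\pi'_{x'})\big)\,\chi(dx,dx').$$ $M\in\Pi^{\mathrm M}(\mu,\nu)$ is a martingale rearrangement coupling of $\pi\in\Pi(\mu,\nu)$ if $\mathcal{AW}_1(\pi,M)=\inf_{M'\in\Pi^{\mathrm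 M}(\mu,\nu)}\mathcal{AW}_1(\pi,M')$. Write $\mu\le_{cx}\nu$ if $\int f\,d\mu\le\int f\,d\nu$ for all convex $f:\mathbb R\to\mathbb R$; $F_\eta^{-1}(u)=\inf\{x:\eta((-\infty,x])\ge u\}$ is the quantile function, and $\eta\le_{st}\eta'$ means $F_\eta^{-1}\le F_{\eta'}^{-1}$ on $(0,1)$. The coupling $\pi\in\Pi(\mu,\nu)$ satisfies the barycentre dispersion assumption if $$\forall a\in\mathbb R,\qquad \int_{[a,\infty)}\big(x-m(\pi_x)\big)\,\mu(dx)\le 0 .$$ Exchange maps. Let $\mathfrak B$ be the set of $(y,\tilde y,\eta,\tilde\eta)\in\mathbb R^2\times\mathcal P_1(\mathbb R)^2$ with $m(\eta)<y\le\tilde y<m(\tilde\eta)$, with the trace of the product $\sigma$-algebra, where $\mathcal P_1(\mathbb R)$ carries the Borel $\sigma$-algebra of weak convergence, and put $p=\frac{m(\tilde\eta)-\tilde y}{y-m(\eta)+m(\tilde\eta)-\tilde y}\in(0,1)$. A pair of measurable maps $\beta,\tilde\beta:\mathfrak B\to\mathcal P_1(\mathbb R)$ is called an exchange pair if for every $(y,\tilde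 y,\eta,\tilde\eta)\in\mathfrak B$ the values $\theta=\beta(y,\tilde y,\eta,\tilde\eta)$ and $\tilde\theta=\tilde\beta(y,\tilde y,\eta,\tilde\eta)$ satisfy $$m(\theta)=y,\quad m(\tilde\theta)=\tilde y,\quad \eta\le_{st}\theta,\quad \tilde\theta\le_{st}\tilde\eta,\quad p\,\theta+(1-p)\,\tilde\theta=p\,\eta+(1-p)\,\tilde\eta .$$ The explicit pair $\beta_\star,\tilde\beta_\star$ is defined as follows: $\beta_\star(y,\tilde y,\eta,\tilde\eta)$ and $\tilde\beta_\star(y,\tilde y,\eta,\tilde\eta)$ are the images of the Lebesgue measure on $[0,1]$ under, respectively, $$u\mapsto \mathbf 1_{\{u<q_\star/p\}}F_{\tilde\eta}^{-1}\Big(\tfrac{1-pu-p}{1-p}\Big)+\mathbf 1_{\{u\ge q_\star/p\}}F_\eta^{-1}(u),\qquad u\mapsto \mathbf 1_{\{u<\frac{q_\star}{1-p}\}}F_\eta^{-1}\Big(\tfrac{(1-p)u}{p}\Big)+\mathbf 1_{\{u\ge\frac{q_\star}{1-p}\}}F_{\tilde\eta}^{-1}\Big(u-\tfrac{q_\star}{1-p}\Big),$$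 where $q_\star$ is the unique $q\in[0,p\wedge(1-p)]$ such that $J(q)=y$ if $p\le\frac12$, and such that $\tilde J(q)=\tilde y$ if $p>\frac12$, with $$J(q)=\int_0^{q/p}F_{\tilde\eta}^{-1}\Big(\tfrac{1-pu-p}{1-p}\Big)du+\int_{q/p}^1F_\eta^{-1}(u)\,du,\qquad \tilde J(q)=\int_0^{\frac q{1-p}}F_\eta^{-1}\Big(\tfrac{(1-p)u}{p}\Big)du+\int_0^{\frac{1-q-p}{1-p}}F_{\tilde\eta}^{-1}(u)\,du .$$ Construction of $M$. Given $\pi\in\Pi(\mu,\nu)$ and an exchange pair $(\beta,\tilde\beta)$, put $G(u)=m(\pi_{F_\mu^{-1}(u)})$, $\Delta_\pm(u)=\int_0^u(F_\mu^{-1}-G)^\pm(v)\,dv$, $\Delta_\pm^{-1}(t)=\inf\{v\in[0,1]:\Delta_\pm(v)\ge t\}$, $\mathcal U^+=\{u\in(0,1):F_\mu^{-1}(u)>G(u)\}$, $\mathcal U^-=\{u\in(0,1):F_\mu^{-1}(u)<G(u)\}$. Let $\phi(u)=\Delta_-^{-1}(\Delta_+(u))$ on $\mathcal U^+$, $\phi(u)=\Delta_+^{-1}(\Delta_-(u))$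 on $\mathcal U^-$, and $\phi(u)=u$ for all other $u\in[0,1]$. Let $$p(u)=\frac{G(\phi(u))-F_\mu^{-1}(\phi(u))}{F_\mu^{-1}(u)-G(u)+G(\phi(u))-F_\mu^{-1}(\phi(u))},$$ $A^+=\{u\in\mathcal U^+:F_\mu^{-1}(\phi(u))<G(\phi(u)),\ \phi(\phi(u))=u,\ p(\phi(u))=1-p(u)\}$ and $A^-=\{u\in\mathcal U^-:F_\mu^{-1}(\phi(u))>G(\phi(u)),\ \phi(\phi(u))=u,\ p(\phi(u))=1-p(u)\}$. With $b(u)=(F_\mu^{-1}(u),F_\mu^{-1}(\phi(u)),\pi_{F_\mu^{-1}(u)},\pi_{F_\mu^{-1}(\phi(u))})$, set $m_u=\beta(b(u))$ for $u\in A^+$, $m_u=\tilde\beta(b(\phi(u)))$ for $u\in A^-$, and $m_u=\pi_{F_\mu^{-1}(u)}$ for all other $u\in(0,1)$ (these objects are determined up to a Lebesgue-null set of $u$). Finally $$M(dx,dy)=\int_0^1\delta_{F_\mu^{-1}(u)}(dx)\,m_u(dy)\,du .$$ Theorem. Let $\mu,\nu\in\mathcal P_1(\mathbb R)$ with $\mu\le_{cx}\nu$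 and $\mu\ne\nu$, and let $\pi\in\Pi(\mu,\nu)$ satisfy the barycentre dispersion assumption. Then $(\beta_\star,\tilde\beta_\star)$ is an exchange pair, and for this pair, and indeed for every exchange pair $(\beta,\tilde\beta)$, the measure $M$ constructed above is a martingale coupling of $\mu$ and $\nu$ which is a martingale rearrangement coupling of $\pi$, with $$\inf_{M'\in\Pi^{\mathrm M}(\mu,\nu)}\mathcal{AW}_1(\pi,M')=\mathcal{AW}_1(\pi,M)=\int_{\mathbb R}\mathcal W_1(\pi_x,M_x)\,\mu(dx)=\int_{\mathbb R}\Big|\int_{\mathbb R}y\,\pi_x(dy)-x\Big|\,\mu(dx)<\infty .$$ -/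

import Mathlib

open MeasureTheory Set

noncomputable section

namespace MartRearr

/-- The disintegration `(π_x)` of a finite measure `π(dx,dy) = π_1(dx) π_x(dy)` with respect to
its first marginal (Mathlib's conditional kernel; the value `0` for infinite `π` is never used). -/
def disint (π : Measure (ℝ × ℝ)) : ℝ → Measure ℝ :=
  open Classical in
  if h : IsFiniteMeasure π then fun x => (@Measure.condKernel ℝ ℝ _ _ _ _ π h) x else fun _ => 0

/-- The mean `∫ y η(dy)`. -/
def mean (η : Measure ℝ) : ℝ := ∫ y, y ∂η

/-- `𝒫₁(ℝ)`: probability measures on the line with finite first moment. -/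
def P1 : Set (Measure ℝ) := {η | IsProbabilityMeasure η ∧ Integrable (fun x : ℝ => x) η}

/-- `Π(μ,ν)`: the couplings of `μ` and `ν`. -/
def couplings (μ ν : Measure ℝ) : Set (Measure (ℝ × ℝ)) := {π | π.fst = μ ∧ π.snd = ν}

/-- `Π^M(μ,ν)`: the martingale couplings of `μ` and `ν`. -/
def martCouplings (μ ν : Measure ℝ) : Set (Measure (ℝ × ℝ)) :=
  {M | M ∈ couplings μ ν ∧ ∀ᵐ x ∂μ, mean (disint M x) = x}

/-- The convex order on `𝒫₁(ℝ)`. A convex function is bounded below by an affine one, so its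
integrals exist in `(-∞, +∞]`; testing with the functions integrable for both measures gives the
same order. -/
def ConvexOrder (μ ν : Measure ℝ) : Prop :=
  ∀ f : ℝ → ℝ, ConvexOn ℝ univ f → Integrable f μ → Integrable f ν → ∫ x, f x ∂μ ≤ ∫ y, f y ∂ν

/-- The Wasserstein distance of index one. -/
def W1 (μ ν : Measure ℝ) : ENNReal :=
  ⨅ γ ∈ couplings μ ν, ∫⁻ z, ENNReal.ofReal |z.1 - z.2| ∂γ

/-- The adapted Wasserstein distance of index one. -/
def AW1 (π π' : Measure (ℝ × ℝ)) : ENNReal :=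
  ⨅ χ ∈ couplings π.fst π'.fst,
    ∫⁻ z, (ENNReal.ofReal |z.1 - z.2| + W1 (disint π z.1) (disint π' z.2)) ∂χ

/-- `M` is a martingale rearrangement coupling of `π ∈ Π(μ,ν)`. -/
def IsMartRearrangement (μ ν : Measure ℝ) (π M : Measure (ℝ × ℝ)) : Prop :=
  M ∈ martCouplings μ ν ∧ AW1 π M = ⨅ M' ∈ martCouplings μ ν, AW1 π M'

/-- Wiesel's barycentre dispersion assumption for a coupling `π` with first marginal `μ`. -/
def BarycentreDispersion (μ : Measure ℝ) (π : Measure (ℝ × ℝ)) : Prop :=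
  ∀ a : ℝ, ∫ x in Ici a, (x - mean (disint π x)) ∂μ ≤ 0

/-- The quantile function `F_η⁻¹(u) = inf {x | η((-∞,x]) ≥ u}`, used for `u ∈ (0,1)`. -/
def quantile (η : Measure ℝ) (u : ℝ) : ℝ := sInf {x : ℝ | u ≤ η.real (Iic x)}

/-- The stochastic order `η ≤_st η'`. -/
def StochOrder (η η' : Measure ℝ) : Prop := ∀ u ∈ Ioo (0 : ℝ) 1, quantile η u ≤ quantile η' u

/-! ### Exchanging mass between two measures -/

/-- The set `𝔅` of the `(y, y', η, η')` with `mean η < y ≤ y' < mean η'`. It carries the trace of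
the product σ-algebra; on probability measures the σ-algebra of `Measure ℝ` is the Borel σ-algebra
of weak convergence. -/
def exchDomain : Set (ℝ × ℝ × Measure ℝ × Measure ℝ) :=
  {b | b.2.2.1 ∈ P1 ∧ b.2.2.2 ∈ P1 ∧
    mean b.2.2.1 < b.1 ∧ b.1 ≤ b.2.1 ∧ b.2.1 < mean b.2.2.2}

/-- The weight `p = (x' - y') / (y - x + x' - y')`, with `x`, `x'` the means of `η`, `η'`. -/
def exchWeight (y y' : ℝ) (η η' : Measure ℝ) : ℝ :=
  (mean η' - y') / (y - mean η + mean η' - y')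

/-- `β`, `β'` are measurable maps from `𝔅` to `𝒫₁(ℝ)` that move the means of `η`, `η'` to `y`, `y'`,
monotonically in the stochastic order, keeping the mixture `p η + (1 - p) η'`. -/
structure IsExchange (β β' : ℝ × ℝ × Measure ℝ × Measure ℝ → Measure ℝ) : Prop where
  measurable_left : Measurable fun b : exchDomain => β b
  measurable_right : Measurable fun b : exchDomain => β' b
  mem_left : ∀ b ∈ exchDomain, β b ∈ P1
  mem_right : ∀ b ∈ exchDomain, β' b ∈ P1
  mean_left : ∀ y y' η η', (y, y', η, η') ∈ exchDomain → mean (β (y, y', η, η')) = y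
  mean_right : ∀ y y' η η', (y, y', η, η') ∈ exchDomain → mean (β' (y, y', η, η')) = y'
  order_left : ∀ y y' η η', (y, y', η, η') ∈ exchDomain → StochOrder η (β (y, y', η, η'))
  order_right : ∀ y y' η η', (y, y', η, η') ∈ exchDomain → StochOrder (β' (y, y', η, η')) η'
  mixture : ∀ y y' η η', (y, y', η, η') ∈ exchDomain →
    ENNReal.ofReal (exchWeight y y' η η') • β (y, y', η, η')
        + ENNReal.ofReal (1 - exchWeight y y' η η') • β' (y, y', η, η')
      = ENNReal.ofReal (exchWeight y y' η η') • η
        + ENNReal.ofReal (1 - exchWeight y y' η η') • η'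

/-- `J(q)`: the mean of `η` after its lowest mass `q` has been exchanged (`η`, `η'` having weights
`p`, `1 - p`) against the highest mass `q` of `η'`. -/
def exchJ (p : ℝ) (η η' : Measure ℝ) (q : ℝ) : ℝ :=
  (∫ u in (0 : ℝ)..(q / p), quantile η' ((1 - p * u - p) / (1 - p)))
    + ∫ u in (q / p)..1, quantile η u

/-- `J'(q)`: the mean of `η'` after the same exchange. -/
def exchJ' (p : ℝ) (η η' : Measure ℝ) (q : ℝ) : ℝ :=
  (∫ u in (0 : ℝ)..(q / (1 - p)), quantile η ((1 - p) * u / p))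
    + ∫ u in (0 : ℝ)..((1 - q - p) / (1 - p)), quantile η' u

/-- `q⋆`: the (unique) `q ∈ [0, p ∧ (1 - p)]` with `J(q) = y` if `p ≤ 1/2`,
with `J'(q) = y'` if `p > 1/2`. -/
def exchMass (y y' : ℝ) (η η' : Measure ℝ) : ℝ :=
  let p := exchWeight y y' η η'
  if p ≤ 1 / 2 then sInf {q | q ∈ Icc 0 (min p (1 - p)) ∧ exchJ p η η' q = y}
  else sInf {q | q ∈ Icc 0 (min p (1 - p)) ∧ exchJ' p η η' q = y'}

/-- The explicit map `β`. -/
def exchLeft (b : ℝ × ℝ × Measure ℝ × Measure ℝ) : Measure ℝ :=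
  let η := b.2.2.1
  let η' := b.2.2.2
  let p := exchWeight b.1 b.2.1 η η'
  let q := exchMass b.1 b.2.1 η η'
  (volume.restrict (Icc (0 : ℝ) 1)).map fun u =>
    if u < q / p then quantile η' ((1 - p * u - p) / (1 - p)) else quantile η u

/-- The explicit map `β'`. -/
def exchRight (b : ℝ × ℝ × Measure ℝ × Measure ℝ) : Measure ℝ :=
  let η := b.2.2.1
  let η' := b.2.2.2
  let p := exchWeight b.1 b.2.1 η η'
  let q := exchMass b.1 b.2.1 η η'
  (volume.restrict (Icc (0 : ℝ) 1)).map fun u =>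
    if u < q / (1 - p) then quantile η ((1 - p) * u / p) else quantile η' (u - q / (1 - p))

/-! ### The construction of the coupling `M` from `π` -/

/-- `F_μ⁻¹`, with `μ` the first marginal of `π`. -/
def quant (π : Measure (ℝ × ℝ)) (u : ℝ) : ℝ := quantile π.fst u

/-- `π_{F_μ⁻¹(u)}`. -/
def fibre (π : Measure (ℝ × ℝ)) (u : ℝ) : Measure ℝ := disint π (quant π u)

/-- `G(u) = ∫ y π_{F_μ⁻¹(u)}(dy)`. -/
def bary (π : Measure (ℝ × ℝ)) (u : ℝ) : ℝ := mean (fibre π u)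

/-- `Δ₊(u) = ∫_0^u (F_μ⁻¹ - G)⁺(v) dv`. -/
def deltaPos (π : Measure (ℝ × ℝ)) (u : ℝ) : ℝ :=
  ∫ v in (0 : ℝ)..u, max (quant π v - bary π v) 0

/-- `Δ₋(u) = ∫_0^u (F_μ⁻¹ - G)⁻(v) dv`. -/
def deltaNeg (π : Measure (ℝ × ℝ)) (u : ℝ) : ℝ :=
  ∫ v in (0 : ℝ)..u, max (bary π v - quant π v) 0

/-- The left continuous generalised inverse `t ↦ inf {v ∈ [0,1] | Δ(v) ≥ t}`. -/
def genInv (Δ : ℝ → ℝ) (t : ℝ) : ℝ := sInf {v | v ∈ Icc (0 : ℝ) 1 ∧ t ≤ Δ v}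

/-- `𝒰⁺`. -/
def UPos (π : Measure (ℝ × ℝ)) : Set ℝ := {u | u ∈ Ioo (0 : ℝ) 1 ∧ bary π u < quant π u}

/-- `𝒰⁻`. -/
def UNeg (π : Measure (ℝ × ℝ)) : Set ℝ := {u | u ∈ Ioo (0 : ℝ) 1 ∧ quant π u < bary π u}

open Classical in
/-- The map `φ`. -/
def phi (π : Measure (ℝ × ℝ)) (u : ℝ) : ℝ :=
  if u ∈ UPos π then genInv (deltaNeg π) (deltaPos π u)
  else if u ∈ UNeg π then genInv (deltaPos π) (deltaNeg π u)
  else u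

/-- The weight `p(u)`. -/
def weight (π : Measure (ℝ × ℝ)) (u : ℝ) : ℝ :=
  (bary π (phi π u) - quant π (phi π u)) /
    (quant π u - bary π u + bary π (phi π u) - quant π (phi π u))

/-- `A⁺`. -/
def APos (π : Measure (ℝ × ℝ)) : Set ℝ :=
  {u | u ∈ UPos π ∧ quant π (phi π u) < bary π (phi π u) ∧ phi π (phi π u) = u ∧
    weight π (phi π u) = 1 - weight π u}

/-- `A⁻`. -/
def ANeg (π : Measure (ℝ × ℝ)) : Set ℝ :=
  {u | u ∈ UNeg π ∧ bary π (phi π u) < quant π (phi π u) ∧ phi π (phi π u) = u ∧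
    weight π (phi π u) = 1 - weight π u}

/-- The quadruple `(F_μ⁻¹(u), F_μ⁻¹(φ(u)), π_{F_μ⁻¹(u)}, π_{F_μ⁻¹(φ(u))})`. -/
def quadruple (π : Measure (ℝ × ℝ)) (u : ℝ) : ℝ × ℝ × Measure ℝ × Measure ℝ :=
  (quant π u, quant π (phi π u), fibre π u, fibre π (phi π u))

open Classical in
/-- The family `(m_u)` obtained from `π` with the exchange maps `β`, `β'`. -/
def mKer (β β' : ℝ × ℝ × Measure ℝ × Measure ℝ → Measure ℝ) (π : Measure (ℝ × ℝ)) (u : ℝ) :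
    Measure ℝ :=
  if u ∈ APos π then β (quadruple π u)
  else if u ∈ ANeg π then β' (quadruple π (phi π u))
  else fibre π u

/-- `M(dx,dy) = ∫_0^1 δ_{F_μ⁻¹(u)}(dx) m_u(dy) du`. -/
def rearrangement (β β' : ℝ × ℝ × Measure ℝ × Measure ℝ → Measure ℝ) (π : Measure (ℝ × ℝ)) :
    Measure (ℝ × ℝ) :=
  (volume.restrict (Ioo (0 : ℝ) 1)).bind fun u =>
    (Measure.dirac (quant π u)).prod (mKer β β' π u)

/-- The full conclusion about a candidate `M`: it is a martingale rearrangement coupling of `π`, and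
`inf AW₁(π,·) = AW₁(π,M) = ∫ W₁(π_x,M_x) μ(dx) = ∫ |∫ y π_x(dy) - x| μ(dx) < ∞`. -/
def RearrangementIdentities (μ ν : Measure ℝ) (π M : Measure (ℝ × ℝ)) : Prop :=
  IsMartRearrangement μ ν π M ∧
  AW1 π M = ∫⁻ x, W1 (disint π x) (disint M x) ∂μ ∧
  ∫⁻ x, W1 (disint π x) (disint M x) ∂μ = ∫⁻ x, ENNReal.ofReal |mean (disint π x) - x| ∂μ ∧
  ∫⁻ x, ENNReal.ofReal |mean (disint π x) - x| ∂μ < ⊤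

end MartRearr

end

/-!
Since `W₁` dominates the difference of means, `∫ |m(π_x) - x| μ(dx)` bounds `AW₁ π M'` from below
for every martingale coupling `M'`; the point is to attain this bound.

Dispersion, transported to `(0, 1)` by the quantile function, says that `Δ₊ ≥ Δ₋`, and equality of
the means that `Δ₊(1) = Δ₋(1)`. So `φ` matches almost every `u ∈ 𝒰⁺` with some `φ(u) ≥ u` in `𝒰⁻`,
and carries `(F_μ⁻¹ - G)⁺ du` to `(F_μ⁻¹ - G)⁻ du`. An exchange of mass between the fibres over
`F_μ⁻¹(u) ≤ F_μ⁻¹(φ(u))` puts both means in place and preserves the mixture of the two fibres in the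
proportions in which `φ` matches them, hence the second marginal. It moves each fibre monotonically
for the stochastic order, so that `W₁` of the displacement is just the displacement of the mean.

The explicit exchange swaps the lowest mass `q` of `η` with the highest mass `q` of `η̃`. The
resulting mean `J(q)` is continuous and concave on `[0, p ∧ (1 - p)]`, with
`J(0) < y ≤ J(p ∧ (1 - p))`. Continuity gives `q⋆`; concavity gives `q⋆ ≤ q ↔ y ≤ J(q)`, which
makes `q⋆` measurable in the data and shows that the values received before `q⋆` exceed those given
away.
-/

open MeasureTheory Set

noncomputable section

namespace MartRearr

/-! ### Quantile functions -/

section Quantile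

variable {η η' : Measure ℝ} {u x : ℝ}

lemma monotone_measureReal_Iic (η : Measure ℝ) [IsFiniteMeasure η] :
    Monotone fun x => η.real (Iic x) := fun _ _ hxy =>
  measureReal_mono (Iic_subset_Iic.2 hxy)

lemma bddBelow_setOf_le_measureReal_Iic [IsProbabilityMeasure η] (hu : 0 < u) :
    BddBelow {x : ℝ | u ≤ η.real (Iic x)} := by
  obtain ⟨a, ha⟩ := ((ProbabilityTheory.tendsto_cdf_atBot η).eventually (gt_mem_nhds hu)).exists
  rw [ProbabilityTheory.cdf_eq_real] at ha
  exact ⟨a, fun y hy =>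
    ((monotone_measureReal_Iic η).reflect_lt (lt_of_lt_of_le ha hy)).le⟩

lemma nonempty_setOf_le_measureReal_Iic [IsProbabilityMeasure η] (hu : u < 1) :
    {x : ℝ | u ≤ η.real (Iic x)}.Nonempty := by
  obtain ⟨a, ha⟩ := ((ProbabilityTheory.tendsto_cdf_atTop η).eventually (lt_mem_nhds hu)).exists
  rw [ProbabilityTheory.cdf_eq_real] at ha
  exact ⟨a, ha.le⟩

lemma quantile_le_iff_of_nonempty [IsProbabilityMeasure η] (hu : 0 < u)
    (hne : {x : ℝ | u ≤ η.real (Iic x)}.Nonempty) :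
    quantile η u ≤ x ↔ u ≤ η.real (Iic x) := by
  refine ⟨fun h => ?_, fun h => csInf_le (bddBelow_setOf_le_measureReal_Iic hu) h⟩
  have hright : ContinuousWithinAt (ProbabilityTheory.cdf η) (Ioi x) x :=
    ((ProbabilityTheory.cdf η).right_continuous x).mono Ioi_subset_Ici_self
  rw [← ProbabilityTheory.cdf_eq_real]
  refine ge_of_tendsto hright ?_
  filter_upwards [self_mem_nhdsWithin] with y hy
  obtain ⟨z, hz, hzy⟩ := exists_lt_of_csInf_lt hne (lt_of_le_of_lt h hy)
  rw [ProbabilityTheory.cdf_eq_real]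
  exact le_trans hz (monotone_measureReal_Iic η hzy.le)

lemma quantile_le_iff [IsProbabilityMeasure η] (hu : u ∈ Ioo (0 : ℝ) 1) :
    quantile η u ≤ x ↔ u ≤ η.real (Iic x) :=
  quantile_le_iff_of_nonempty hu.1 (nonempty_setOf_le_measureReal_Iic hu.2)

-- Outside the range of levels that matter the infimum is over `univ` or `∅`, and `sInf` of both
-- is `0`.
lemma quantile_of_nonpos (η : Measure ℝ) (hu : u ≤ 0) : quantile η u = 0 := by
  have huniv : {x : ℝ | u ≤ η.real (Iic x)} = univ :=
    eq_univ_of_forall fun _ => hu.trans measureReal_nonneg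
  rw [quantile, huniv, Real.sInf_univ]

lemma quantile_of_forall_natCast_lt [IsFiniteMeasure η] (hu : ∀ n : ℕ, η.real (Iic (n : ℝ)) < u) :
    quantile η u = 0 := by
  have hempty : {x : ℝ | u ≤ η.real (Iic x)} = ∅ :=
    eq_empty_of_forall_notMem fun y hy =>
      have ⟨n, hn⟩ := exists_nat_ge y
      (hu n).not_ge (le_trans hy (monotone_measureReal_Iic η hn))
  rw [quantile, hempty, Real.sInf_empty]

lemma monotoneOn_quantile (η : Measure ℝ) [IsProbabilityMeasure η] :
    MonotoneOn (quantile η) (Ioo 0 1) := fun _ ha _ hb hab =>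
  (quantile_le_iff ha).2 (hab.trans ((quantile_le_iff hb).1 le_rfl))

lemma measurable_quantile_uncurry {Ω : Type*} [MeasurableSpace Ω] {κ : Ω → Measure ℝ}
    (hκ : Measurable κ) (hp : ∀ ω, IsProbabilityMeasure (κ ω)) :
    Measurable fun z : Ω × ℝ => quantile (κ z.1) z.2 := by
  have hcdf (y : ℝ) : MeasurableSet {z : Ω × ℝ | z.2 ≤ (κ z.1).real (Iic y)} :=
    measurableSet_le measurable_snd
      (((Measure.measurable_coe measurableSet_Iic).comp hκ).ennreal_toReal.comp measurable_fst)
  let S : Set (Ω × ℝ) := {z | 0 < z.2} ∩ ⋃ n : ℕ, {z | z.2 ≤ (κ z.1).real (Iic (n : ℝ))}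
  have hS : MeasurableSet S := (measurableSet_lt measurable_const measurable_snd).inter
    (MeasurableSet.iUnion fun n => hcdf n)
  refine measurable_of_Iic fun x => ?_
  have hpre : (fun z : Ω × ℝ => quantile (κ z.1) z.2) ⁻¹' Iic x
      = (S ∩ {z | z.2 ≤ (κ z.1).real (Iic x)}) ∪ (Sᶜ ∩ {_z | 0 ≤ x}) := by
    ext ⟨ω, u⟩
    have := hp ω
    by_cases hz : (ω, u) ∈ S
    · obtain ⟨n, hn⟩ := mem_iUnion.1 hz.2
      simp [hz, quantile_le_iff_of_nonempty hz.1 ⟨n, hn⟩]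
    · have hzero : quantile (κ ω) u = 0 := by
        rcases le_or_gt u 0 with hu | hu
        · exact quantile_of_nonpos _ hu
        · exact quantile_of_forall_natCast_lt fun n =>
            not_le.1 fun hn => hz ⟨hu, mem_iUnion.2 ⟨n, hn⟩⟩
      simp [hz, hzero]
  rw [hpre]
  exact (hS.inter (hcdf x)).union (hS.compl.inter (MeasurableSet.const _))

lemma measurable_quantile (η : Measure ℝ) [hη : IsProbabilityMeasure η] :
    Measurable (quantile η) :=
  (measurable_quantile_uncurry (κ := fun _ : Unit => η) measurable_const fun _ => hη).comp
    (measurable_const.prodMk measurable_id : Measurable fun u : ℝ => ((), u))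

lemma volume_Iic_inter_Ioo {c T : ℝ} (hc : c ≤ T) :
    volume (Iic c ∩ Ioo 0 T) = ENNReal.ofReal c := by
  rw [measure_congr ((ae_eq_refl (Iic c)).inter Ioo_ae_eq_Ioc), inter_comm,
    Ioc_inter_Iic, min_eq_right hc, Real.volume_Ioc, sub_zero]

/-- Lebesgue measure on the unit interval. -/
abbrev lebUnit : Measure ℝ := volume.restrict (Ioo 0 1)

instance isProbabilityMeasure_lebUnit : IsProbabilityMeasure lebUnit := ⟨by simp⟩

lemma map_quantile (η : Measure ℝ) [IsProbabilityMeasure η] : lebUnit.map (quantile η) = η := by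
  have : IsProbabilityMeasure (lebUnit.map (quantile η)) :=
    Measure.isProbabilityMeasure_map (measurable_quantile η).aemeasurable
  refine Measure.ext_of_Iic _ _ fun x => ?_
  have hpre : quantile η ⁻¹' Iic x ∩ Ioo 0 1 = Iic (η.real (Iic x)) ∩ Ioo 0 1 := by
    ext u
    exact and_congr_left fun hu => quantile_le_iff hu
  rw [Measure.map_apply (measurable_quantile η) measurableSet_Iic,
    Measure.restrict_apply (measurable_quantile η measurableSet_Iic), hpre,
    volume_Iic_inter_Ioo measureReal_le_one, ofReal_measureReal]

lemma integrableOn_quantile (hη : η ∈ P1) : IntegrableOn (quantile η) (Ioo 0 1) := by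
  have := hη.1
  have hmap : Integrable (fun x : ℝ => x) (lebUnit.map (quantile η)) := by
    rw [map_quantile]
    exact hη.2
  exact hmap.comp_measurable (measurable_quantile η)

lemma mean_eq_setIntegral_quantile [IsProbabilityMeasure η] :
    mean η = ∫ u in Ioo (0 : ℝ) 1, quantile η u := by
  conv_lhs => rw [mean, ← map_quantile η]
  exact integral_map (measurable_quantile η).aemeasurable aestronglyMeasurable_id

lemma mean_eq_intervalIntegral_quantile [IsProbabilityMeasure η] :
    mean η = ∫ u in (0 : ℝ)..1, quantile η u := by
  rw [mean_eq_setIntegral_quantile, intervalIntegral.integral_of_le zero_le_one,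
    integral_Ioc_eq_integral_Ioo]

lemma stochOrder_of_forall_rat_measure_Iic_le [IsProbabilityMeasure η] [IsProbabilityMeasure η']
    (h : ∀ t : ℚ, η' (Iic (t : ℝ)) ≤ η (Iic (t : ℝ))) : StochOrder η η' := by
  intro u hu
  by_contra! hlt
  obtain ⟨t, ht, ht'⟩ := exists_rat_btwn hlt
  have hcdf : η'.real (Iic (t : ℝ)) ≤ η.real (Iic (t : ℝ)) :=
    ENNReal.toReal_mono (measure_ne_top _ _) (h t)
  exact ht'.not_ge ((quantile_le_iff hu).2 (((quantile_le_iff hu).1 ht.le).trans hcdf))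

lemma StochOrder.measure_Iic_le [IsProbabilityMeasure η] [IsProbabilityMeasure η']
    (h : StochOrder η η') (t : ℝ) : η' (Iic t) ≤ η (Iic t) := by
  conv_lhs => rw [← map_quantile η']
  conv_rhs => rw [← map_quantile η]
  rw [Measure.map_apply (measurable_quantile _) measurableSet_Iic,
    Measure.map_apply (measurable_quantile _) measurableSet_Iic,
    Measure.restrict_apply (measurable_quantile _ measurableSet_Iic),
    Measure.restrict_apply (measurable_quantile _ measurableSet_Iic)]
  exact measure_mono fun u hu => ⟨(h u hu.2).trans hu.1, hu.2⟩

end Quantile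

/-! ### Couplings and the Wasserstein distance -/

section Wasserstein

variable {η η' : Measure ℝ} {γ : Measure (ℝ × ℝ)}

lemma integrable_fst_of_mem_couplings (hη : Integrable (fun x : ℝ => x) η)
    (hγ : γ ∈ couplings η η') : Integrable (fun z => z.1) γ :=
  Integrable.comp_measurable (f := Prod.fst) (hγ.1 ▸ hη) measurable_fst

lemma integrable_snd_of_mem_couplings (hη' : Integrable (fun x : ℝ => x) η')
    (hγ : γ ∈ couplings η η') : Integrable (fun z => z.2) γ :=
  Integrable.comp_measurable (f := Prod.snd) (hγ.2 ▸ hη') measurable_snd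

lemma mean_fst (γ : Measure (ℝ × ℝ)) : mean γ.fst = ∫ z, z.1 ∂γ :=
  integral_map measurable_fst.aemeasurable aestronglyMeasurable_id

lemma mean_snd (γ : Measure (ℝ × ℝ)) : mean γ.snd = ∫ z, z.2 ∂γ :=
  integral_map measurable_snd.aemeasurable aestronglyMeasurable_id

lemma lintegral_ofReal_abs_sub_of_ae_le {α : Type*} [MeasurableSpace α] {ρ : Measure α}
    {f g : α → ℝ} (hf : Integrable f ρ) (hg : Integrable g ρ) (hfg : f ≤ᵐ[ρ] g) :
    ∫⁻ a, ENNReal.ofReal |f a - g a| ∂ρ = ENNReal.ofReal |∫ a, f a ∂ρ - ∫ a, g a ∂ρ| := by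
  have habs : (fun a => |f a - g a|) =ᵐ[ρ] fun a => g a - f a := by
    filter_upwards [hfg] with a ha
    rw [abs_sub_comm, abs_of_nonneg (sub_nonneg.2 ha)]
  rw [← ofReal_integral_eq_lintegral_ofReal (f := fun a => |f a - g a|) (hf.sub hg).abs
    (Filter.Eventually.of_forall fun _ => abs_nonneg _), integral_congr_ae habs,
    integral_sub hg hf, abs_sub_comm, abs_of_nonneg (sub_nonneg.2 (integral_mono_ae hf hg hfg))]

lemma couplings_comm (hγ : γ ∈ couplings η η') : γ.map Prod.swap ∈ couplings η' η :=
  ⟨(Measure.fst_map_swap).trans hγ.2, (Measure.snd_map_swap).trans hγ.1⟩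

lemma W1_comm (η η' : Measure ℝ) : W1 η η' = W1 η' η := by
  suffices h : ∀ ζ ζ' : Measure ℝ, W1 ζ ζ' ≤ W1 ζ' ζ from le_antisymm (h _ _) (h _ _)
  refine fun ζ ζ' => le_iInf₂ fun γ hγ => (iInf₂_le _ (couplings_comm hγ)).trans ?_
  refine (lintegral_map_le _ _).trans_eq ?_
  simp only [Prod.fst_swap, Prod.snd_swap, abs_sub_comm]

lemma W1_le_lintegral_quantile [IsProbabilityMeasure η] [IsProbabilityMeasure η'] :
    W1 η η' ≤ ∫⁻ u in Ioo (0 : ℝ) 1, ENNReal.ofReal |quantile η u - quantile η' u| := by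
  have hm : Measurable fun u => (quantile η u, quantile η' u) :=
    (measurable_quantile η).prodMk (measurable_quantile η')
  have hmem : lebUnit.map (fun u => (quantile η u, quantile η' u)) ∈ couplings η η' :=
    ⟨(Measure.map_map measurable_fst hm).trans (map_quantile η),
      (Measure.map_map measurable_snd hm).trans (map_quantile η')⟩
  exact (iInf₂_le _ hmem).trans (lintegral_map_le _ _)

lemma StochOrder.W1_le (hη : η ∈ P1) (hη' : η' ∈ P1) (h : StochOrder η η') :
    W1 η η' ≤ ENNReal.ofReal |mean η - mean η'| := by
  have := hη.1
  have := hη'.1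
  rw [mean_eq_setIntegral_quantile, mean_eq_setIntegral_quantile]
  exact W1_le_lintegral_quantile.trans_eq <| lintegral_ofReal_abs_sub_of_ae_le
    (integrableOn_quantile hη) (integrableOn_quantile hη')
    (ae_restrict_of_forall_mem measurableSet_Ioo h)

lemma ofReal_abs_mean_sub_le_W1 (hη : Integrable (fun x : ℝ => x) η)
    (hη' : Integrable (fun x : ℝ => x) η') :
    ENNReal.ofReal |mean η - mean η'| ≤ W1 η η' := by
  refine le_iInf₂ fun γ hγ => ?_
  have hfst := integrable_fst_of_mem_couplings hη hγ
  have hsnd := integrable_snd_of_mem_couplings hη' hγ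
  rw [← ofReal_integral_eq_lintegral_ofReal (f := fun z : ℝ × ℝ => |z.1 - z.2|)
    (hfst.sub hsnd).abs (Filter.Eventually.of_forall fun _ => abs_nonneg _),
    ← hγ.1, ← hγ.2, mean_fst, mean_snd, ← integral_sub hfst hsnd]
  exact ENNReal.ofReal_le_ofReal abs_integral_le_integral_abs

end Wasserstein

/-! ### Measurability on the space of measures -/

section Measurability

lemma measurableSet_integrable_id :
    MeasurableSet {η : Measure ℝ | Integrable (fun x : ℝ => x) η} := by
  have h : {η : Measure ℝ | Integrable (fun x : ℝ => x) η} = {η | ∫⁻ x, ‖x‖ₑ ∂η < ⊤} := by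
    ext η
    exact ⟨fun h => h.2, fun h => ⟨aestronglyMeasurable_id, h⟩⟩
  rw [h]
  exact measurableSet_lt (Measure.measurable_lintegral measurable_enorm) measurable_const

lemma measurableSet_P1 : MeasurableSet P1 := by
  have h : P1 = {η : Measure ℝ | η univ = 1} ∩ {η | Integrable (fun x : ℝ => x) η} := by
    ext η
    exact ⟨fun h => ⟨h.1.measure_univ, h.2⟩, fun h => ⟨⟨h.1⟩, h.2⟩⟩
  rw [h]
  exact ((Measure.measurable_coe MeasurableSet.univ) (measurableSet_singleton 1)).inter
    measurableSet_integrable_id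

lemma measurable_mean : Measurable mean := by
  classical
  have h : mean = fun η : Measure ℝ =>
      if η ∈ {η : Measure ℝ | Integrable (fun x : ℝ => x) η} then
        (∫⁻ x, ENNReal.ofReal x ∂η).toReal - (∫⁻ x, ENNReal.ofReal (-x) ∂η).toReal
      else 0 := by
    ext η
    split_ifs with hη
    · exact integral_eq_lintegral_pos_part_sub_lintegral_neg_part hη
    · exact integral_undef hη
  rw [h]
  exact Measurable.ite measurableSet_integrable_id
    ((Measure.measurable_lintegral ENNReal.measurable_ofReal).ennreal_toReal.sub
      (Measure.measurable_lintegral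
        (ENNReal.measurable_ofReal.comp measurable_neg)).ennreal_toReal)
    measurable_const

lemma measurableSet_exchDomain : MeasurableSet exchDomain := by
  have hy : Measurable fun b : ℝ × ℝ × Measure ℝ × Measure ℝ => b.1 := measurable_fst
  have hy' : Measurable fun b : ℝ × ℝ × Measure ℝ × Measure ℝ => b.2.1 :=
    measurable_fst.comp measurable_snd
  have hη : Measurable fun b : ℝ × ℝ × Measure ℝ × Measure ℝ => b.2.2.1 :=
    measurable_fst.comp (measurable_snd.comp measurable_snd)
  have hη' : Measurable fun b : ℝ × ℝ × Measure ℝ × Measure ℝ => b.2.2.2 :=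
    measurable_snd.comp (measurable_snd.comp measurable_snd)
  exact (hη measurableSet_P1).inter ((hη' measurableSet_P1).inter
    ((measurableSet_lt (measurable_mean.comp hη) hy).inter
      ((measurableSet_le hy hy').inter (measurableSet_lt hy' (measurable_mean.comp hη')))))

end Measurability

/-! ### Time changes by primitives of nonnegative functions -/

section GenInv

variable {Δ : ℝ → ℝ} {t v : ℝ}

lemma genInv_mem_Icc (ht : t ≤ Δ 1) : genInv Δ t ∈ Icc (0 : ℝ) 1 :=
  have hbdd : BddBelow {v | v ∈ Icc (0 : ℝ) 1 ∧ t ≤ Δ v} := ⟨0, fun _ hw => hw.1.1⟩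
  ⟨le_csInf ⟨1, right_mem_Icc.2 zero_le_one, ht⟩ fun _ hw => hw.1.1,
    csInf_le hbdd ⟨right_mem_Icc.2 zero_le_one, ht⟩⟩

lemma genInv_le_iff (hc : ContinuousOn Δ (Icc 0 1)) (hm : MonotoneOn Δ (Icc 0 1)) (ht : t ≤ Δ 1)
    (hv : v ∈ Icc (0 : ℝ) 1) : genInv Δ t ≤ v ↔ t ≤ Δ v := by
  have hbdd : BddBelow {v | v ∈ Icc (0 : ℝ) 1 ∧ t ≤ Δ v} := ⟨0, fun w hw => hw.1.1⟩
  have hclosed : IsClosed {v | v ∈ Icc (0 : ℝ) 1 ∧ t ≤ Δ v} :=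
    hc.preimage_isClosed_of_isClosed isClosed_Icc isClosed_Ici
  have hmem : genInv Δ t ∈ {v | v ∈ Icc (0 : ℝ) 1 ∧ t ≤ Δ v} :=
    hclosed.csInf_mem ⟨1, right_mem_Icc.2 zero_le_one, ht⟩ hbdd
  exact ⟨fun h => hmem.2.trans (hm hmem.1 hv h), fun h => csInf_le hbdd ⟨hv, h⟩⟩

lemma apply_genInv (hc : ContinuousOn Δ (Icc 0 1)) (hm : MonotoneOn Δ (Icc 0 1))
    (ht : t ∈ Icc (Δ 0) (Δ 1)) : Δ (genInv Δ t) = t := by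
  refine le_antisymm ?_ ((genInv_le_iff hc hm ht.2 (genInv_mem_Icc ht.2)).1 le_rfl)
  obtain ⟨w, hw, rfl⟩ := intermediate_value_Icc zero_le_one hc ht
  exact hm (genInv_mem_Icc ht.2) hw ((genInv_le_iff hc hm ht.2 hw).2 le_rfl)

lemma monotoneOn_genInv (hc : ContinuousOn Δ (Icc 0 1)) (hm : MonotoneOn Δ (Icc 0 1)) :
    MonotoneOn (genInv Δ) (Iic (Δ 1)) := fun _ hs _ ht hst =>
  (genInv_le_iff hc hm hs (genInv_mem_Icc ht)).2
    (hst.trans ((genInv_le_iff hc hm ht (genInv_mem_Icc ht)).1 le_rfl))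

end GenInv

section TimeChange

/-- The primitive of `f` vanishing at `0`. -/
abbrev primitive (f : ℝ → ℝ) (u : ℝ) : ℝ := ∫ v in (0 : ℝ)..u, f v

variable {f g : ℝ → ℝ}

lemma continuousOn_primitive (hi : IntegrableOn f (Ioo 0 1)) :
    ContinuousOn (primitive f) (Icc 0 1) := by
  have h : IntegrableOn f (uIcc 0 1) := by
    rwa [uIcc_of_le zero_le_one, integrableOn_Icc_iff_integrableOn_Ioo]
  simpa only [uIcc_of_le zero_le_one] using intervalIntegral.continuousOn_primitive_interval h

lemma intervalIntegrable_of_mem_Icc (hi : IntegrableOn f (Ioo 0 1)) {a b : ℝ}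
    (ha : a ∈ Icc (0 : ℝ) 1) (hb : b ∈ Icc (0 : ℝ) 1) : IntervalIntegrable f volume a b := by
  refine ((intervalIntegrable_iff_integrableOn_Ioo_of_le zero_le_one).2 hi).mono_set ?_
  rw [uIcc_of_le zero_le_one]
  exact uIcc_subset_Icc ha hb

/-- A nonnegative measurable function integrable over the unit interval, regarded as the density of
a finite measure there. -/
structure UnitDensity (f : ℝ → ℝ) : Prop where
  measurable : Measurable f
  nonneg : ∀ u, 0 ≤ f u
  integrableOn : IntegrableOn f (Ioo 0 1)

/-- The measure with density `f` on the unit interval. -/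
abbrev densUnit (f : ℝ → ℝ) : Measure ℝ := lebUnit.withDensity fun u => ENNReal.ofReal (f u)

/-- The monotone map that transports the density `f` to the density `g` of the same total mass. -/
def timeChange (f g : ℝ → ℝ) (u : ℝ) : ℝ := genInv (primitive g) (primitive f u)

lemma densUnit_absolutelyContinuous : densUnit f ≪ lebUnit :=
  withDensity_absolutelyContinuous _ _

namespace UnitDensity

lemma continuousOn (hf : UnitDensity f) : ContinuousOn (primitive f) (Icc 0 1) :=
  continuousOn_primitive hf.integrableOn

lemma monotoneOn (hf : UnitDensity f) : MonotoneOn (primitive f) (Icc 0 1) := by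
  intro a ha b hb hab
  have hadd := intervalIntegral.integral_add_adjacent_intervals
    (intervalIntegrable_of_mem_Icc hf.integrableOn (left_mem_Icc.2 zero_le_one) ha)
    (intervalIntegrable_of_mem_Icc hf.integrableOn ha hb)
  have hnonneg : 0 ≤ ∫ v in a..b, f v := intervalIntegral.integral_nonneg hab fun u _ => hf.nonneg u
  simp only [primitive]
  linarith

lemma primitive_mem_Icc (hf : UnitDensity f) {u : ℝ} (hu : u ∈ Icc (0 : ℝ) 1) :
    primitive f u ∈ Icc 0 (primitive f 1) :=
  ⟨intervalIntegral.integral_nonneg hu.1 fun v _ => hf.nonneg v,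
    hf.monotoneOn hu (right_mem_Icc.2 zero_le_one) hu.2⟩

lemma primitive_genInv (hf : UnitDensity f) {t : ℝ} (ht : t ∈ Icc 0 (primitive f 1)) :
    primitive f (genInv (primitive f) t) = t :=
  apply_genInv hf.continuousOn hf.monotoneOn
    ⟨(intervalIntegral.integral_same (f := f)).trans_le ht.1, ht.2⟩

lemma isFiniteMeasure_densUnit (hf : UnitDensity f) : IsFiniteMeasure (densUnit f) :=
  isFiniteMeasure_withDensity_ofReal hf.integrableOn.2

lemma ae_densUnit_iff (hf : UnitDensity f) {p : ℝ → Prop} :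
    (∀ᵐ u ∂(densUnit f), p u) ↔ ∀ᵐ u ∂lebUnit, 0 < f u → p u := by
  rw [ae_withDensity_iff hf.measurable.ennreal_ofReal]
  simp only [ne_eq, ENNReal.ofReal_eq_zero, not_le]

lemma lintegral_densUnit (hf : UnitDensity f) {K : ℝ → ENNReal}
    (hK : AEMeasurable K (densUnit f)) :
    ∫⁻ u, K u ∂densUnit f = ∫⁻ u in {u | 0 < f u}, ENNReal.ofReal (f u) * K u ∂lebUnit := by
  have hsupp : Function.support ((fun u => ENNReal.ofReal (f u)) * K) ⊆ {u | 0 < f u} :=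
    fun u hu => ENNReal.ofReal_pos.1 (pos_iff_ne_zero.2 (left_ne_zero_of_mul hu))
  rw [densUnit, lintegral_withDensity_eq_lintegral_mul₀' hf.measurable.ennreal_ofReal.aemeasurable
    hK, ← indicator_eq_self.2 hsupp,
    lintegral_indicator (measurableSet_lt measurable_const hf.measurable)]
  rfl

lemma aemeasurable_genInv (hf : UnitDensity f) :
    AEMeasurable (genInv (primitive f)) (volume.restrict (Ioo 0 (primitive f 1))) :=
  aemeasurable_restrict_of_monotoneOn measurableSet_Ioo
    ((monotoneOn_genInv hf.continuousOn hf.monotoneOn).mono fun _ ht => ht.2.le)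

lemma genInv_le_iff_le_projIcc (hf : UnitDensity f) {t x : ℝ} (ht : t ∈ Ioo 0 (primitive f 1)) :
    genInv (primitive f) t ≤ x ↔ t ≤ primitive f (projIcc 0 1 zero_le_one x) := by
  rw [← genInv_le_iff hf.continuousOn hf.monotoneOn ht.2.le (projIcc 0 1 zero_le_one x).2,
    coe_projIcc, le_max_iff, le_min_iff]
  have hmem := genInv_mem_Icc ht.2.le
  have hpos : ¬ genInv (primitive f) t ≤ 0 := by
    rw [genInv_le_iff hf.continuousOn hf.monotoneOn ht.2.le (left_mem_Icc.2 zero_le_one),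
      primitive, intervalIntegral.integral_same, not_le]
    exact ht.1
  simp only [hpos, hmem.2, true_and, false_or]

lemma densUnit_Iic (hf : UnitDensity f) (x : ℝ) :
    densUnit f (Iic x) = ENNReal.ofReal (primitive f (projIcc 0 1 zero_le_one x)) := by
  set c : ℝ := ↑(projIcc 0 1 zero_le_one x)
  have hc : c ∈ Icc (0 : ℝ) 1 := (projIcc 0 1 zero_le_one x).2
  have hinter : Iic x ∩ Ioc 0 1 = Ioc 0 c := by
    ext v
    simp only [c, coe_projIcc, mem_inter_iff, mem_Iic, mem_Ioc, le_max_iff, le_min_iff]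
    grind
  have hset : (Iic x ∩ Ioo 0 1 : Set ℝ) =ᵐ[volume] Ioc 0 c :=
    hinter ▸ (ae_eq_refl (Iic x)).inter Ioo_ae_eq_Ioc
  rw [withDensity_apply _ measurableSet_Iic, Measure.restrict_restrict measurableSet_Iic,
    setLIntegral_congr hset, primitive, intervalIntegral.integral_of_le hc.1]
  exact (ofReal_integral_eq_lintegral_ofReal
    (intervalIntegrable_of_mem_Icc hf.integrableOn (left_mem_Icc.2 zero_le_one) hc).1
    (Filter.Eventually.of_forall hf.nonneg)).symm

lemma map_genInv (hf : UnitDensity f) :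
    (volume.restrict (Ioo 0 (primitive f 1))).map (genInv (primitive f)) = densUnit f := by
  have := hf.isFiniteMeasure_densUnit
  refine Measure.ext_of_Iic _ _ fun x => ?_
  have hpre : genInv (primitive f) ⁻¹' Iic x ∩ Ioo 0 (primitive f 1)
      = Iic (primitive f (projIcc 0 1 zero_le_one x)) ∩ Ioo 0 (primitive f 1) := by
    ext t
    exact and_congr_left fun ht => hf.genInv_le_iff_le_projIcc ht
  rw [Measure.map_apply_of_aemeasurable hf.aemeasurable_genInv measurableSet_Iic,
    Measure.restrict_apply' measurableSet_Ioo, hpre,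
    volume_Iic_inter_Ioo (hf.primitive_mem_Icc (projIcc 0 1 zero_le_one x).2).2, hf.densUnit_Iic]

lemma aemeasurable_primitive (hf : UnitDensity f) : AEMeasurable (primitive f) (densUnit f) :=
  ((hf.continuousOn.mono Ioo_subset_Icc_self).aemeasurable measurableSet_Ioo).mono_ac
    densUnit_absolutelyContinuous

lemma map_primitive (hf : UnitDensity f) :
    (densUnit f).map (primitive f) = volume.restrict (Ioo 0 (primitive f 1)) := by
  have hprim := hf.aemeasurable_primitive
  rw [← hf.map_genInv] at hprim ⊢
  rw [AEMeasurable.map_map_of_aemeasurable hprim hf.aemeasurable_genInv]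
  conv_rhs => rw [← Measure.map_id (μ := volume.restrict (Ioo 0 (primitive f 1)))]
  refine Measure.map_congr ?_
  filter_upwards [ae_restrict_mem measurableSet_Ioo] with t ht
  exact hf.primitive_genInv (Ioo_subset_Icc_self ht)

lemma aemeasurable_timeChange (hf : UnitDensity f) (hg : UnitDensity g)
    (hT : primitive f 1 = primitive g 1) : AEMeasurable (timeChange f g) lebUnit :=
  aemeasurable_restrict_of_monotoneOn measurableSet_Ioo fun _ ha _ hb hab =>
    monotoneOn_genInv hg.continuousOn hg.monotoneOn
      ((hf.primitive_mem_Icc (Ioo_subset_Icc_self ha)).2.trans_eq hT)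
      ((hf.primitive_mem_Icc (Ioo_subset_Icc_self hb)).2.trans_eq hT)
      (hf.monotoneOn (Ioo_subset_Icc_self ha) (Ioo_subset_Icc_self hb) hab)

lemma map_timeChange (hf : UnitDensity f) (hg : UnitDensity g)
    (hT : primitive f 1 = primitive g 1) : (densUnit f).map (timeChange f g) = densUnit g := by
  have hinv := hg.aemeasurable_genInv
  rw [← hT, ← hf.map_primitive] at hinv
  have hmap := AEMeasurable.map_map_of_aemeasurable hinv hf.aemeasurable_primitive
  rw [hf.map_primitive, hT, hg.map_genInv] at hmap
  exact hmap.symm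

lemma timeChange_self_ae (hf : UnitDensity f) : ∀ᵐ u ∂densUnit f, timeChange f f u = u := by
  obtain ⟨k, hk, hTk⟩ := (hf.aemeasurable_timeChange hf rfl).mono_ac
    (densUnit_absolutelyContinuous (f := f))
  have hkid : ∀ᵐ u ∂densUnit f, k u = u := by
    rw [← hf.map_genInv] at hTk ⊢
    rw [ae_map_iff hf.aemeasurable_genInv (measurableSet_eq_fun hk measurable_id')]
    filter_upwards [ae_of_ae_map hf.aemeasurable_genInv hTk, ae_restrict_mem measurableSet_Ioo]
      with t ht htI
    rw [← ht, timeChange, hf.primitive_genInv (Ioo_subset_Icc_self htI)]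
  filter_upwards [hTk, hkid] with u hu hu'
  rw [hu, hu']

lemma ae_timeChange (hf : UnitDensity f) (hg : UnitDensity g)
    (hT : primitive f 1 = primitive g 1) {p : ℝ → Prop} (hp : ∀ᵐ v ∂densUnit g, p v) :
    ∀ᵐ u ∂densUnit f, p (timeChange f g u) := by
  rw [← hf.map_timeChange hg hT] at hp
  exact ae_of_ae_map ((hf.aemeasurable_timeChange hg hT).mono_ac
    densUnit_absolutelyContinuous) hp

lemma timeChange_mem_ae (hf : UnitDensity f) (hg : UnitDensity g)
    (hT : primitive f 1 = primitive g 1) :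
    ∀ᵐ u ∂densUnit f, timeChange f g u ∈ Ioo (0 : ℝ) 1 ∧ 0 < g (timeChange f g u) := by
  have hmem : ∀ᵐ v ∂densUnit g, v ∈ Ioo (0 : ℝ) 1 ∧ 0 < g v := by
    rw [hg.ae_densUnit_iff]
    filter_upwards [ae_restrict_mem measurableSet_Ioo] with v hv hgv using ⟨hv, hgv⟩
  exact hf.ae_timeChange hg hT hmem

lemma timeChange_timeChange_ae (hf : UnitDensity f) (hg : UnitDensity g)
    (hT : primitive f 1 = primitive g 1) :
    ∀ᵐ u ∂densUnit f, timeChange g f (timeChange f g u) = u := by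
  filter_upwards [hf.timeChange_self_ae, densUnit_absolutelyContinuous.ae_le
    (ae_restrict_mem measurableSet_Ioo)] with u hu huI
  rw [timeChange, timeChange, hg.primitive_genInv
    (hT ▸ hf.primitive_mem_Icc (Ioo_subset_Icc_self huI))]
  exact hu

lemma setLIntegral_eq_timeChange (hf : UnitDensity f) (hg : UnitDensity g)
    (hT : primitive f 1 = primitive g 1) {H : ℝ → ENNReal} (hH : AEMeasurable H lebUnit) :
    ∫⁻ v in {v | 0 < g v}, H v ∂lebUnit = ∫⁻ u in {u | 0 < f u}, ENNReal.ofReal (f u) *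
      (H (timeChange f g u) / ENNReal.ofReal (g (timeChange f g u))) ∂lebUnit := by
  have hquot : AEMeasurable (fun v => H v / ENNReal.ofReal (g v)) (densUnit g) :=
    (hH.div hg.measurable.ennreal_ofReal.aemeasurable).mono_ac densUnit_absolutelyContinuous
  have htc : AEMeasurable (timeChange f g) (densUnit f) :=
    (hf.aemeasurable_timeChange hg hT).mono_ac densUnit_absolutelyContinuous
  have hquot' := hquot
  rw [← hf.map_timeChange hg hT] at hquot'
  calc ∫⁻ v in {v | 0 < g v}, H v ∂lebUnit
      = ∫⁻ v in {v | 0 < g v}, ENNReal.ofReal (g v) * (H v / ENNReal.ofReal (g v)) ∂lebUnit :=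
        setLIntegral_congr_fun (measurableSet_lt measurable_const hg.measurable) fun v hv =>
          (ENNReal.mul_div_cancel (ENNReal.ofReal_pos.2 hv).ne' ENNReal.ofReal_ne_top).symm
    _ = ∫⁻ v, H v / ENNReal.ofReal (g v) ∂(densUnit f).map (timeChange f g) := by
        rw [hf.map_timeChange hg hT, hg.lintegral_densUnit hquot]
    _ = _ := by
        rw [lintegral_map' hquot' htc]
        exact hf.lintegral_densUnit (hquot'.comp_aemeasurable htc)

end UnitDensity

end TimeChange

/-! ### Disintegrations -/

section Disintegration

variable {μ ν : Measure ℝ} {π : Measure (ℝ × ℝ)}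

lemma isProbabilityMeasure_of_mem_couplings [IsProbabilityMeasure μ] (hπ : π ∈ couplings μ ν) :
    IsProbabilityMeasure π :=
  ⟨by rw [← Measure.fst_univ, hπ.1, measure_univ]⟩

lemma disint_eq_condKernel [hfin : IsFiniteMeasure π] : disint π = π.condKernel := by
  rw [disint, dif_pos hfin]

instance isProbabilityMeasure_disint [IsFiniteMeasure π] (x : ℝ) :
    IsProbabilityMeasure (disint π x) := by
  rw [disint_eq_condKernel]
  infer_instance

lemma measurable_disint [IsFiniteMeasure π] : Measurable (disint π) := by
  rw [disint_eq_condKernel]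
  exact π.condKernel.measurable

lemma measurable_mean_disint [IsFiniteMeasure π] : Measurable fun x => mean (disint π x) :=
  measurable_mean.comp measurable_disint

lemma setLIntegral_disint [IsFiniteMeasure π] {s t : Set ℝ} (hs : MeasurableSet s)
    (ht : MeasurableSet t) : ∫⁻ x in s, disint π x t ∂π.fst = π (s ×ˢ t) := by
  rw [disint_eq_condKernel]
  exact Measure.setLIntegral_condKernel_eq_measure_prod hs ht

lemma disint_mem_P1_ae [IsFiniteMeasure π] (hint : Integrable (fun z : ℝ × ℝ => z.2) π) :
    ∀ᵐ x ∂π.fst, disint π x ∈ P1 := by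
  filter_upwards [hint.condKernel_ae] with x hx
  exact ⟨inferInstance, by rwa [disint_eq_condKernel]⟩

lemma integrable_mean_disint [IsFiniteMeasure π] (hint : Integrable (fun z : ℝ × ℝ => z.2) π) :
    Integrable (fun x => mean (disint π x)) π.fst := by
  simp only [disint_eq_condKernel, mean]
  exact hint.integral_condKernel

lemma setIntegral_mean_disint [IsFiniteMeasure π] (hint : Integrable (fun z : ℝ × ℝ => z.2) π)
    {s : Set ℝ} (hs : MeasurableSet s) :
    ∫ x in s, mean (disint π x) ∂π.fst = ∫ z in s ×ˢ univ, z.2 ∂π := by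
  simp only [disint_eq_condKernel, mean]
  exact Measure.setIntegral_condKernel_univ_right (f := fun z : ℝ × ℝ => z.2) hs
    hint.integrableOn

lemma integral_mean_disint [IsFiniteMeasure π] (hint : Integrable (fun z : ℝ × ℝ => z.2) π) :
    ∫ x, mean (disint π x) ∂π.fst = mean π.snd := by
  rw [mean_snd, ← setIntegral_univ, setIntegral_mean_disint hint MeasurableSet.univ,
    univ_prod_univ, setIntegral_univ]

lemma ConvexOrder.mean_eq (hcx : ConvexOrder μ ν) (hμ : Integrable (fun x : ℝ => x) μ)
    (hν : Integrable (fun x : ℝ => x) ν) : mean μ = mean ν := by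
  refine le_antisymm (hcx (fun x => x) (convexOn_id convex_univ) hμ hν) ?_
  have hneg := hcx (fun x => -x) (concaveOn_id convex_univ).neg hμ.neg hν.neg
  rwa [integral_neg, integral_neg, neg_le_neg_iff] at hneg

end Disintegration

/-! ### Couplings assembled from a family of measures -/

section Assemble

open ProbabilityTheory

variable {Ω : Type*} [MeasurableSpace Ω] {P : Measure Ω} {Q : Ω → ℝ} {m m' : Ω → Measure ℝ}

/-- The law of `(Q u, Y)`, where `u` has law `P` and `Y` has law `m u` given `u`. The fibres of a
coupling and the rearranged family `(m_u)` both give a law of this form, with the same `P` and `Q`;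
a point `x` may have several preimages under `Q`, over which the disintegration averages. -/
def assemble (P : Measure Ω) (Q : Ω → ℝ) (m : Ω → Measure ℝ) : Measure (ℝ × ℝ) :=
  P.bind fun u => (Measure.dirac (Q u)).prod (m u)

lemma exists_isMarkovKernel_ae_eq (hm : AEMeasurable m P)
    (hprob : ∀ᵐ u ∂P, IsProbabilityMeasure (m u)) :
    ∃ κ : Kernel Ω ℝ, IsMarkovKernel κ ∧ m =ᵐ[P] κ := by
  obtain ⟨k, hk, hrange, hmk⟩ := hm.exists_ae_eq_range_subset hprob
    ⟨Measure.dirac 0, Measure.dirac.isProbabilityMeasure⟩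
  exact ⟨⟨k, hk⟩, ⟨fun u => hrange (mem_range_self u)⟩, hmk⟩

lemma assemble_eq_map_compProd [SFinite P] (hQ : Measurable Q) {κ : Kernel Ω ℝ} [IsSFiniteKernel κ]
    (hmκ : m =ᵐ[P] κ) : assemble P Q m = (P ⊗ₘ κ).map (Prod.map Q id) := by
  have hfam : ∀ᵐ u ∂P, (Measure.dirac (Q u)).prod (m u) = (Kernel.deterministic Q hQ ×ₖ κ) u := by
    filter_upwards [hmκ] with u hu
    rw [hu, Kernel.prod_apply, Kernel.deterministic_apply]
  have hQid : Measurable (Prod.map Q id : Ω × ℝ → ℝ × ℝ) := hQ.prodMap measurable_id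
  rw [assemble, Measure.bind_congr_right hfam]
  ext s hs
  rw [Measure.bind_apply hs (Kernel.measurable _).aemeasurable, Measure.map_apply hQid hs,
    Measure.compProd_apply (hQid hs)]
  refine lintegral_congr fun u => ?_
  rw [Kernel.prod_apply, Kernel.deterministic_apply, Measure.dirac_prod,
    Measure.map_apply measurable_prodMk_left hs]
  rfl

lemma fst_assemble [SFinite P] (hQ : Measurable Q) (hm : AEMeasurable m P)
    (hprob : ∀ᵐ u ∂P, IsProbabilityMeasure (m u)) : (assemble P Q m).fst = P.map Q := by
  obtain ⟨κ, hκ, hmκ⟩ := exists_isMarkovKernel_ae_eq hm hprob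
  rw [assemble_eq_map_compProd hQ hmκ, Measure.fst,
    Measure.map_map measurable_fst (hQ.prodMap measurable_id), Prod.map_fst',
    ← Measure.map_map hQ measurable_fst, ← Measure.fst, Measure.fst_compProd]

lemma assemble_prod [SFinite P] (hQ : Measurable Q) (hm : AEMeasurable m P)
    (hprob : ∀ᵐ u ∂P, IsProbabilityMeasure (m u)) {s t : Set ℝ} (hs : MeasurableSet s)
    (ht : MeasurableSet t) : assemble P Q m (s ×ˢ t) = ∫⁻ u in Q ⁻¹' s, m u t ∂P := by
  obtain ⟨κ, hκ, hmκ⟩ := exists_isMarkovKernel_ae_eq hm hprob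
  rw [assemble_eq_map_compProd hQ hmκ, Measure.map_apply (hQ.prodMap measurable_id) (hs.prod ht),
    preimage_prod_map_prod, preimage_id, Measure.compProd_apply_prod (hQ hs) ht]
  refine lintegral_congr_ae (ae_restrict_of_ae ?_)
  filter_upwards [hmκ] with u hu
  rw [hu]

lemma snd_assemble_apply [SFinite P] (hQ : Measurable Q) (hm : AEMeasurable m P)
    (hprob : ∀ᵐ u ∂P, IsProbabilityMeasure (m u)) {t : Set ℝ} (ht : MeasurableSet t) :
    (assemble P Q m).snd t = ∫⁻ u, m u t ∂P := by
  rw [Measure.snd_apply ht, ← univ_prod, assemble_prod hQ hm hprob MeasurableSet.univ ht,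
    preimage_univ, setLIntegral_univ]

lemma isFiniteMeasure_assemble [IsFiniteMeasure P] (hQ : Measurable Q) (hm : AEMeasurable m P)
    (hprob : ∀ᵐ u ∂P, IsProbabilityMeasure (m u)) : IsFiniteMeasure (assemble P Q m) := by
  refine ⟨?_⟩
  rw [← Measure.fst_univ, fst_assemble hQ hm hprob]
  exact measure_lt_top _ _

lemma assemble_disint [SFinite P] {π : Measure (ℝ × ℝ)} [IsFiniteMeasure π] (hQ : Measurable Q)
    (hPQ : P.map Q = π.fst) : assemble P Q (fun u => disint π (Q u)) = π := by
  refine (Measure.ext_prod fun {s t} hs ht => ?_).symm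
  rw [assemble_prod (m := fun u => disint π (Q u)) hQ (measurable_disint.comp hQ).aemeasurable
    (Filter.Eventually.of_forall fun u => isProbabilityMeasure_disint (Q u)) hs ht,
    ← setLIntegral_disint hs ht, ← hPQ]
  exact setLIntegral_map hs ((Measure.measurable_coe ht).comp measurable_disint) hQ

lemma setIntegral_snd_assemble [SFinite P] (hQ : Measurable Q) (hm : AEMeasurable m P)
    (hprob : ∀ᵐ u ∂P, IsProbabilityMeasure (m u))
    (hint : Integrable (fun z : ℝ × ℝ => z.2) (assemble P Q m)) {s : Set ℝ}
    (hs : MeasurableSet s) :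
    ∫ z in s ×ˢ univ, z.2 ∂assemble P Q m = ∫ u in Q ⁻¹' s, mean (m u) ∂P := by
  obtain ⟨κ, hκ, hmκ⟩ := exists_isMarkovKernel_ae_eq hm hprob
  have hQid : AEMeasurable (Prod.map Q id : Ω × ℝ → ℝ × ℝ) (P ⊗ₘ κ) :=
    (hQ.prodMap measurable_id).aemeasurable
  rw [assemble_eq_map_compProd hQ hmκ] at hint ⊢
  have hintκ : Integrable (fun z : Ω × ℝ => z.2) (P ⊗ₘ κ) :=
    (integrable_map_measure measurable_snd.aestronglyMeasurable hQid).1 hint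
  rw [setIntegral_map (hs.prod MeasurableSet.univ) measurable_snd.aestronglyMeasurable hQid,
    preimage_prod_map_prod, preimage_id]
  refine (Measure.setIntegral_compProd (f := fun z : Ω × ℝ => z.2) (hQ hs) MeasurableSet.univ
    hintκ.integrableOn).trans (integral_congr_ae (ae_restrict_of_ae ?_))
  filter_upwards [hmκ] with u hu
  rw [setIntegral_univ, ← hu, mean]

lemma mean_disint_assemble_ae [IsFiniteMeasure P] (hQ : Measurable Q) (hm : AEMeasurable m P)
    (hprob : ∀ᵐ u ∂P, IsProbabilityMeasure (m u)) (hmean : ∀ᵐ u ∂P, mean (m u) = Q u)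
    (hQint : Integrable (fun x => x) (P.map Q))
    (hint : Integrable (fun z : ℝ × ℝ => z.2) (assemble P Q m)) :
    ∀ᵐ x ∂P.map Q, mean (disint (assemble P Q m) x) = x := by
  have := isFiniteMeasure_assemble hQ hm hprob
  have hfst := fst_assemble hQ hm hprob
  refine (hfst ▸ integrable_mean_disint hint).ae_eq_of_forall_setIntegral_eq _ _ hQint
    fun s hs _ => ?_
  calc ∫ x in s, mean (disint (assemble P Q m) x) ∂P.map Q
      = ∫ u in Q ⁻¹' s, mean (m u) ∂P := by
        rw [← hfst, setIntegral_mean_disint hint hs, setIntegral_snd_assemble hQ hm hprob hint hs]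
    _ = ∫ u in Q ⁻¹' s, Q u ∂P := integral_congr_ae (ae_restrict_of_ae hmean)
    _ = ∫ x in s, x ∂P.map Q :=
        (setIntegral_map hs aestronglyMeasurable_id hQ.aemeasurable).symm

lemma disint_assemble_le_ae [IsFiniteMeasure P] (hQ : Measurable Q) (hm : AEMeasurable m P)
    (hprob : ∀ᵐ u ∂P, IsProbabilityMeasure (m u)) (hm' : AEMeasurable m' P)
    (hprob' : ∀ᵐ u ∂P, IsProbabilityMeasure (m' u)) {S t : Set ℝ} (hS : MeasurableSet S)
    (ht : MeasurableSet t) (hle : ∀ᵐ u ∂P, Q u ∈ S → m u t ≤ m' u t) :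
    ∀ᵐ x ∂P.map Q, x ∈ S → disint (assemble P Q m) x t ≤ disint (assemble P Q m') x t := by
  have := isFiniteMeasure_assemble hQ hm hprob
  have := isFiniteMeasure_assemble hQ hm' hprob'
  rw [← ae_restrict_iff' hS]
  refine ae_le_of_forall_setLIntegral_le_of_sigmaFinite
    ((Measure.measurable_coe ht).comp measurable_disint) fun A hA _ => ?_
  rw [Measure.restrict_restrict hA]
  calc ∫⁻ x in A ∩ S, disint (assemble P Q m) x t ∂P.map Q
      = ∫⁻ u in Q ⁻¹' (A ∩ S), m u t ∂P := by
        rw [← fst_assemble hQ hm hprob, setLIntegral_disint (hA.inter hS) ht,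
          assemble_prod hQ hm hprob (hA.inter hS) ht]
    _ ≤ ∫⁻ u in Q ⁻¹' (A ∩ S), m' u t ∂P := by
        refine lintegral_mono_ae ((ae_restrict_iff' (hQ (hA.inter hS))).2 ?_)
        filter_upwards [hle] with u hu huA using hu huA.2
    _ = ∫⁻ x in A ∩ S, disint (assemble P Q m') x t ∂P.map Q := by
        rw [← fst_assemble hQ hm' hprob', setLIntegral_disint (hA.inter hS) ht,
          assemble_prod hQ hm' hprob' (hA.inter hS) ht]

end Assemble

/-! ### The exchange of positions `φ` -/

section Phi

variable {μ ν : Measure ℝ} {π : Measure (ℝ × ℝ)}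

/-- A coupling that satisfies the barycentre dispersion assumption, of two elements of `𝒫₁(ℝ)` with
the same mean. The equality of the means encodes `μ ≤_cx ν`, to which it is equivalent under
dispersion. -/
structure DispersedCoupling (μ ν : Measure ℝ) (π : Measure (ℝ × ℝ)) : Prop where
  left_mem : μ ∈ P1
  right_mem : ν ∈ P1
  mean_eq : mean μ = mean ν
  mem : π ∈ couplings μ ν
  dispersion : BarycentreDispersion μ π

/-- The positive part of `F_μ⁻¹ - G`, the density of `Δ₊`. -/
def excessPos (π : Measure (ℝ × ℝ)) (u : ℝ) : ℝ := max (quant π u - bary π u) 0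

/-- The negative part of `F_μ⁻¹ - G`, the density of `Δ₋`. -/
def excessNeg (π : Measure (ℝ × ℝ)) (u : ℝ) : ℝ := max (bary π u - quant π u) 0

lemma excessPos_sub_excessNeg (u : ℝ) :
    excessPos π u - excessNeg π u = quant π u - bary π u := by
  have hsub := posPart_sub_negPart (quant π u - bary π u)
  rwa [posPart_def, negPart_def, neg_sub] at hsub

lemma excessPos_of_mem_UPos {u : ℝ} (hu : u ∈ UPos π) : excessPos π u = quant π u - bary π u :=
  max_eq_left (sub_nonneg.2 hu.2.le)

lemma excessNeg_of_mem_UNeg {u : ℝ} (hu : u ∈ UNeg π) : excessNeg π u = bary π u - quant π u :=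
  max_eq_left (sub_nonneg.2 hu.2.le)

lemma mem_UPos_iff {u : ℝ} : u ∈ UPos π ↔ u ∈ Ioo (0 : ℝ) 1 ∧ 0 < excessPos π u := by
  simp [UPos, excessPos]

lemma mem_UNeg_iff {u : ℝ} : u ∈ UNeg π ↔ u ∈ Ioo (0 : ℝ) 1 ∧ 0 < excessNeg π u := by
  simp [UNeg, excessNeg]

lemma UPos_ae_eq : UPos π =ᵐ[lebUnit] {u | 0 < excessPos π u} := by
  filter_upwards [ae_restrict_mem measurableSet_Ioo] with u hu
  exact propext (mem_UPos_iff.trans (and_iff_right hu))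

lemma UNeg_ae_eq : UNeg π =ᵐ[lebUnit] {u | 0 < excessNeg π u} := by
  filter_upwards [ae_restrict_mem measurableSet_Ioo] with u hu
  exact propext (mem_UNeg_iff.trans (and_iff_right hu))

lemma disjoint_UPos_UNeg : Disjoint (UPos π) (UNeg π) :=
  Set.disjoint_left.2 fun _ hpos hneg => lt_asymm hpos.2 hneg.2

lemma phi_of_mem_UPos {u : ℝ} (hu : u ∈ UPos π) :
    phi π u = timeChange (excessPos π) (excessNeg π) u := by
  rw [phi, if_pos hu]
  rfl

lemma phi_of_mem_UNeg {u : ℝ} (hu : u ∈ UNeg π) :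
    phi π u = timeChange (excessNeg π) (excessPos π) u := by
  rw [phi, if_neg (Set.disjoint_right.1 disjoint_UPos_UNeg hu), if_pos hu]
  rfl

lemma weight_phi {u : ℝ} (hu : u ∈ UPos π ∧ phi π u ∈ UNeg π ∨ u ∈ UNeg π ∧ phi π u ∈ UPos π)
    (hphi : phi π (phi π u) = u) : weight π (phi π u) = 1 - weight π u := by
  simp only [weight, hphi]
  have hden : quant π u - bary π u + bary π (phi π u) - quant π (phi π u) ≠ 0 := by
    rcases hu with ⟨hu, hphiu⟩ | ⟨hu, hphiu⟩
    · exact ne_of_gt (by linarith [hu.2, hphiu.2])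
    · exact ne_of_lt (by linarith [hu.2, hphiu.2])
  have hden' : quant π (phi π u) - bary π (phi π u) + bary π u - quant π u ≠ 0 :=
    fun h0 => hden (by linarith)
  field_simp
  ring

namespace DispersedCoupling

lemma isProbabilityMeasure (h : DispersedCoupling μ ν π) : IsProbabilityMeasure π :=
  have := h.left_mem.1
  isProbabilityMeasure_of_mem_couplings h.mem

lemma integrable_snd (h : DispersedCoupling μ ν π) : Integrable (fun z : ℝ × ℝ => z.2) π :=
  integrable_snd_of_mem_couplings h.right_mem.2 h.mem

lemma quant_eq (h : DispersedCoupling μ ν π) : quant π = quantile μ :=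
  funext fun u => by rw [quant, h.mem.1]

lemma measurable_quant (h : DispersedCoupling μ ν π) : Measurable (quant π) := by
  have := h.left_mem.1
  exact h.quant_eq ▸ measurable_quantile μ

lemma map_quant (h : DispersedCoupling μ ν π) : lebUnit.map (quant π) = μ := by
  have := h.left_mem.1
  exact h.quant_eq ▸ map_quantile μ

lemma monotoneOn_quant (h : DispersedCoupling μ ν π) : MonotoneOn (quant π) (Ioo 0 1) := by
  have := h.left_mem.1
  exact h.quant_eq ▸ monotoneOn_quantile μ

lemma measurable_fibre (h : DispersedCoupling μ ν π) : Measurable (fibre π) :=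
  have := h.isProbabilityMeasure
  measurable_disint.comp h.measurable_quant

lemma isProbabilityMeasure_fibre (h : DispersedCoupling μ ν π) (u : ℝ) :
    IsProbabilityMeasure (fibre π u) :=
  have := h.isProbabilityMeasure
  isProbabilityMeasure_disint _

lemma measurable_bary (h : DispersedCoupling μ ν π) : Measurable (bary π) :=
  measurable_mean.comp h.measurable_fibre

lemma disint_mem_P1_ae (h : DispersedCoupling μ ν π) : ∀ᵐ x ∂μ, disint π x ∈ P1 := by
  have := h.isProbabilityMeasure
  exact h.mem.1 ▸ MartRearr.disint_mem_P1_ae h.integrable_snd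

lemma fibre_mem_P1_ae (h : DispersedCoupling μ ν π) : ∀ᵐ u ∂lebUnit, fibre π u ∈ P1 :=
  ae_of_ae_map h.measurable_quant.aemeasurable (h.map_quant.symm ▸ h.disint_mem_P1_ae)

lemma integrable_mean_disint (h : DispersedCoupling μ ν π) :
    Integrable (fun x => mean (disint π x)) μ := by
  have := h.isProbabilityMeasure
  exact h.mem.1 ▸ MartRearr.integrable_mean_disint h.integrable_snd

lemma integrable_excess (h : DispersedCoupling μ ν π) :
    Integrable (fun x => x - mean (disint π x)) μ :=
  h.left_mem.2.sub h.integrable_mean_disint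

lemma integral_excess (h : DispersedCoupling μ ν π) :
    ∫ x, (x - mean (disint π x)) ∂μ = 0 := by
  have := h.isProbabilityMeasure
  have hmean := integral_mean_disint h.integrable_snd
  rw [h.mem.1, h.mem.2, ← h.mean_eq] at hmean
  rw [integral_sub h.left_mem.2 h.integrable_mean_disint, hmean, mean, sub_self]

lemma integral_excess_Iio_nonneg (h : DispersedCoupling μ ν π) (a : ℝ) :
    0 ≤ ∫ x in Iio a, (x - mean (disint π x)) ∂μ := by
  have hsum := integral_add_compl (measurableSet_Iio (a := a)) h.integrable_excess
  rw [h.integral_excess, compl_Iio] at hsum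
  linarith [h.dispersion a]

lemma integral_excess_Iic_nonneg (h : DispersedCoupling μ ν π) (a : ℝ) :
    0 ≤ ∫ x in Iic a, (x - mean (disint π x)) ∂μ := by
  obtain ⟨b, hanti, hlt, hlim⟩ := exists_seq_strictAnti_tendsto a
  have hinter : ⋂ n, Iio (b n) = Iic a := by
    ext x
    simp only [mem_iInter, mem_Iio, mem_Iic]
    exact ⟨fun hx => ge_of_tendsto' hlim fun n => (hx n).le, fun hx n => hx.trans_lt (hlt n)⟩
  have htend := tendsto_setIntegral_of_antitone (fun n => measurableSet_Iio (a := b n))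
    (fun _ _ hmn => Iio_subset_Iio (hanti.antitone hmn)) ⟨0, h.integrable_excess.integrableOn⟩
  rw [hinter] at htend
  exact ge_of_tendsto' htend fun n => h.integral_excess_Iio_nonneg _

lemma integrableOn_quant_sub_bary (h : DispersedCoupling μ ν π) :
    IntegrableOn (fun u => quant π u - bary π u) (Ioo 0 1) := by
  have hmap : Integrable (fun x => x - mean (disint π x)) (lebUnit.map (quant π)) :=
    h.map_quant.symm ▸ h.integrable_excess
  exact hmap.comp_measurable h.measurable_quant

lemma setIntegral_quant_preimage (h : DispersedCoupling μ ν π) {s : Set ℝ}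
    (hs : MeasurableSet s) :
    ∫ u in quant π ⁻¹' s ∩ Ioo 0 1, (quant π u - bary π u)
      = ∫ x in s, (x - mean (disint π x)) ∂μ := by
  have hmeas : AEStronglyMeasurable (fun x => x - mean (disint π x)) (lebUnit.map (quant π)) :=
    h.map_quant.symm ▸ h.integrable_excess.aestronglyMeasurable
  conv_rhs => rw [← h.map_quant]
  rw [setIntegral_map hs hmeas h.measurable_quant.aemeasurable,
    Measure.restrict_restrict (h.measurable_quant hs)]
  rfl

/- On the level set of `F_μ⁻¹` through `u` the integrand is constant: if it is nonnegative there,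
drop that level set from `(0, u]`, otherwise complete it. What remains is a sublevel set of
`F_μ⁻¹`, for which the dispersion assumption applies. -/
lemma integral_quant_sub_bary_nonneg_of_bary_le (h : DispersedCoupling μ ν π) {u : ℝ}
    (hu : u ∈ Ioo (0 : ℝ) 1) (hle : bary π u ≤ quant π u) :
    0 ≤ ∫ v in Ioc 0 u, (quant π v - bary π v) := by
  have hsub : Ioc 0 u ⊆ Ioo 0 1 := fun v hv => ⟨hv.1, hv.2.trans_lt hu.2⟩
  set S := quant π ⁻¹' Iio (quant π u) ∩ Ioo 0 1 with hS
  have hSm : MeasurableSet S := (h.measurable_quant measurableSet_Iio).inter measurableSet_Ioo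
  have hSu : S ⊆ Ioc 0 u := fun v hv =>
    ⟨hv.2.1, not_lt.1 fun huv => (h.monotoneOn_quant hu hv.2 huv.le).not_gt hv.1⟩
  have hdiff := setIntegral_sdiff hSm (h.integrableOn_quant_sub_bary.mono_set hsub) hSu
  have hsublevel : 0 ≤ ∫ v in S, (quant π v - bary π v) := by
    rw [hS, h.setIntegral_quant_preimage measurableSet_Iio]
    exact h.integral_excess_Iio_nonneg _
  have hlevel : 0 ≤ ∫ v in Ioc 0 u \ S, (quant π v - bary π v) := by
    refine setIntegral_nonneg (measurableSet_Ioc.diff hSm) fun v hv => ?_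
    have hquant : quant π v = quant π u := le_antisymm (h.monotoneOn_quant (hsub hv.1) hu hv.1.2)
      (not_lt.1 fun hlt => hv.2 ⟨hlt, hsub hv.1⟩)
    rwa [bary, fibre, hquant, sub_nonneg]
  linarith

lemma integral_quant_sub_bary_nonneg_of_le_bary (h : DispersedCoupling μ ν π) {u : ℝ}
    (hu : u ∈ Ioo (0 : ℝ) 1) (hle : quant π u ≤ bary π u) :
    0 ≤ ∫ v in Ioc 0 u, (quant π v - bary π v) := by
  have hsub : Ioc 0 u ⊆ Ioo 0 1 := fun v hv => ⟨hv.1, hv.2.trans_lt hu.2⟩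
  set S := quant π ⁻¹' Iic (quant π u) ∩ Ioo 0 1 with hS
  have hSm : MeasurableSet S := (h.measurable_quant measurableSet_Iic).inter measurableSet_Ioo
  have huS : Ioc 0 u ⊆ S := fun v hv => ⟨h.monotoneOn_quant (hsub hv) hu hv.2, hsub hv⟩
  have hdiff := setIntegral_sdiff measurableSet_Ioc
    (h.integrableOn_quant_sub_bary.mono_set (inter_subset_right : S ⊆ _)) huS
  have hsublevel : 0 ≤ ∫ v in S, (quant π v - bary π v) := by
    rw [hS, h.setIntegral_quant_preimage measurableSet_Iic]
    exact h.integral_excess_Iic_nonneg _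
  have hlevel : ∫ v in S \ Ioc 0 u, (quant π v - bary π v) ≤ 0 := by
    refine setIntegral_nonpos (hSm.diff measurableSet_Ioc) fun v hv => ?_
    have huv : u ≤ v := not_lt.1 fun hvu => hv.2 ⟨hv.1.2.1, hvu.le⟩
    have hquant : quant π v = quant π u :=
      le_antisymm hv.1.1 (h.monotoneOn_quant hu hv.1.2 huv)
    rwa [bary, fibre, hquant, sub_nonpos]
  linarith

lemma unitDensity_excessPos (h : DispersedCoupling μ ν π) : UnitDensity (excessPos π) where
  measurable := (h.measurable_quant.sub h.measurable_bary).max measurable_const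
  nonneg _ := le_max_right _ _
  integrableOn := h.integrableOn_quant_sub_bary.pos_part

lemma unitDensity_excessNeg (h : DispersedCoupling μ ν π) : UnitDensity (excessNeg π) where
  measurable := (h.measurable_bary.sub h.measurable_quant).max measurable_const
  nonneg _ := le_max_right _ _
  integrableOn := by
    have hneg := h.integrableOn_quant_sub_bary.neg_part
    simp only [neg_sub] at hneg
    exact hneg

lemma measurableSet_UPos (h : DispersedCoupling μ ν π) : MeasurableSet (UPos π) :=
  measurableSet_Ioo.inter (measurableSet_lt h.measurable_bary h.measurable_quant)

lemma measurableSet_UNeg (h : DispersedCoupling μ ν π) : MeasurableSet (UNeg π) :=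
  measurableSet_Ioo.inter (measurableSet_lt h.measurable_quant h.measurable_bary)

lemma primitive_excessPos_sub_primitive_excessNeg (h : DispersedCoupling μ ν π) {u : ℝ}
    (hu : u ∈ Icc (0 : ℝ) 1) : primitive (excessPos π) u - primitive (excessNeg π) u
      = ∫ v in Ioc 0 u, (quant π v - bary π v) := by
  have hzero : (0 : ℝ) ∈ Icc (0 : ℝ) 1 := left_mem_Icc.2 zero_le_one
  rw [primitive, primitive, ← intervalIntegral.integral_sub
    (intervalIntegrable_of_mem_Icc h.unitDensity_excessPos.integrableOn hzero hu)
    (intervalIntegrable_of_mem_Icc h.unitDensity_excessNeg.integrableOn hzero hu),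
    intervalIntegral.integral_of_le hu.1]
  simp only [excessPos_sub_excessNeg]

lemma primitive_excessPos_one (h : DispersedCoupling μ ν π) :
    primitive (excessPos π) 1 = primitive (excessNeg π) 1 := by
  have htotal := h.setIntegral_quant_preimage MeasurableSet.univ
  rw [preimage_univ, univ_inter, Measure.restrict_univ, h.integral_excess] at htotal
  rw [← sub_eq_zero, h.primitive_excessPos_sub_primitive_excessNeg (right_mem_Icc.2 zero_le_one),
    integral_Ioc_eq_integral_Ioo, htotal]

lemma primitive_excessNeg_le (h : DispersedCoupling μ ν π) {u : ℝ} (hu : u ∈ Icc (0 : ℝ) 1) :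
    primitive (excessNeg π) u ≤ primitive (excessPos π) u := by
  rcases hu.1.eq_or_lt with rfl | hpos
  · simp only [primitive, intervalIntegral.integral_same, le_refl]
  rcases hu.2.eq_or_lt with rfl | hlt
  · exact h.primitive_excessPos_one.ge
  rw [← sub_nonneg, h.primitive_excessPos_sub_primitive_excessNeg hu]
  rcases le_total (bary π u) (quant π u) with hle | hle
  · exact h.integral_quant_sub_bary_nonneg_of_bary_le ⟨hpos, hlt⟩ hle
  · exact h.integral_quant_sub_bary_nonneg_of_le_bary ⟨hpos, hlt⟩ hle

lemma genInv_primitive_excessPos_le (h : DispersedCoupling μ ν π) {t : ℝ}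
    (ht : t ≤ primitive (excessPos π) 1) :
    genInv (primitive (excessPos π)) t ≤ genInv (primitive (excessNeg π)) t :=
  csInf_le_csInf ⟨0, fun _ hv => hv.1.1⟩
    ⟨1, right_mem_Icc.2 zero_le_one, ht.trans_eq h.primitive_excessPos_one⟩
    fun _ hv => ⟨hv.1, hv.2.trans (h.primitive_excessNeg_le hv.1)⟩

lemma le_phi_ae_of_mem_UPos (h : DispersedCoupling μ ν π) :
    ∀ᵐ u ∂lebUnit, u ∈ UPos π → u ≤ phi π u := by
  filter_upwards [h.unitDensity_excessPos.ae_densUnit_iff.1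
    h.unitDensity_excessPos.timeChange_self_ae] with u hself hu
  rw [phi_of_mem_UPos hu]
  conv_lhs => rw [← hself (mem_UPos_iff.1 hu).2]
  exact h.genInv_primitive_excessPos_le
    (h.unitDensity_excessPos.primitive_mem_Icc (Ioo_subset_Icc_self hu.1)).2

lemma phi_mem_UNeg_ae (h : DispersedCoupling μ ν π) :
    ∀ᵐ u ∂lebUnit, u ∈ UPos π → phi π u ∈ UNeg π := by
  filter_upwards [h.unitDensity_excessPos.ae_densUnit_iff.1
    (h.unitDensity_excessPos.timeChange_mem_ae h.unitDensity_excessNeg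
      h.primitive_excessPos_one)] with u hmem hu
  rw [phi_of_mem_UPos hu, mem_UNeg_iff]
  exact hmem (mem_UPos_iff.1 hu).2

lemma phi_mem_UPos_ae (h : DispersedCoupling μ ν π) :
    ∀ᵐ u ∂lebUnit, u ∈ UNeg π → phi π u ∈ UPos π := by
  filter_upwards [h.unitDensity_excessNeg.ae_densUnit_iff.1
    (h.unitDensity_excessNeg.timeChange_mem_ae h.unitDensity_excessPos
      h.primitive_excessPos_one.symm)] with u hmem hu
  rw [phi_of_mem_UNeg hu, mem_UPos_iff]
  exact hmem (mem_UNeg_iff.1 hu).2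

lemma phi_phi_ae_of_mem_UPos (h : DispersedCoupling μ ν π) :
    ∀ᵐ u ∂lebUnit, u ∈ UPos π → phi π (phi π u) = u := by
  filter_upwards [h.phi_mem_UNeg_ae, h.unitDensity_excessPos.ae_densUnit_iff.1
    (h.unitDensity_excessPos.timeChange_timeChange_ae h.unitDensity_excessNeg
      h.primitive_excessPos_one)] with u hmem hinv hu
  rw [phi_of_mem_UNeg (hmem hu), phi_of_mem_UPos hu]
  exact hinv (mem_UPos_iff.1 hu).2

lemma phi_phi_ae_of_mem_UNeg (h : DispersedCoupling μ ν π) :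
    ∀ᵐ u ∂lebUnit, u ∈ UNeg π → phi π (phi π u) = u := by
  filter_upwards [h.phi_mem_UPos_ae, h.unitDensity_excessNeg.ae_densUnit_iff.1
    (h.unitDensity_excessNeg.timeChange_timeChange_ae h.unitDensity_excessPos
      h.primitive_excessPos_one.symm)] with u hmem hinv hu
  rw [phi_of_mem_UPos (hmem hu), phi_of_mem_UNeg hu]
  exact hinv (mem_UNeg_iff.1 hu).2

lemma comp_phi_ae_of_mem_UPos (h : DispersedCoupling μ ν π) {p : ℝ → Prop}
    (hp : ∀ᵐ u ∂lebUnit, p u) : ∀ᵐ u ∂lebUnit, u ∈ UPos π → p (phi π u) := by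
  filter_upwards [h.unitDensity_excessPos.ae_densUnit_iff.1
    (h.unitDensity_excessPos.ae_timeChange h.unitDensity_excessNeg h.primitive_excessPos_one
      (densUnit_absolutelyContinuous.ae_le hp))] with u hpu hu
  rw [phi_of_mem_UPos hu]
  exact hpu (mem_UPos_iff.1 hu).2

lemma comp_phi_ae_of_mem_UNeg (h : DispersedCoupling μ ν π) {p : ℝ → Prop}
    (hp : ∀ᵐ u ∂lebUnit, p u) : ∀ᵐ u ∂lebUnit, u ∈ UNeg π → p (phi π u) := by
  filter_upwards [h.unitDensity_excessNeg.ae_densUnit_iff.1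
    (h.unitDensity_excessNeg.ae_timeChange h.unitDensity_excessPos h.primitive_excessPos_one.symm
      (densUnit_absolutelyContinuous.ae_le hp))] with u hpu hu
  rw [phi_of_mem_UNeg hu]
  exact hpu (mem_UNeg_iff.1 hu).2

lemma mem_APos_iff_ae (h : DispersedCoupling μ ν π) :
    ∀ᵐ u ∂lebUnit, u ∈ APos π ↔ u ∈ UPos π := by
  filter_upwards [h.phi_mem_UNeg_ae, h.phi_phi_ae_of_mem_UPos] with u hmem hinv
  exact ⟨fun hA => hA.1, fun hu =>
    ⟨hu, (hmem hu).2, hinv hu, weight_phi (Or.inl ⟨hu, hmem hu⟩) (hinv hu)⟩⟩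

lemma mem_ANeg_iff_ae (h : DispersedCoupling μ ν π) :
    ∀ᵐ u ∂lebUnit, u ∈ ANeg π ↔ u ∈ UNeg π := by
  filter_upwards [h.phi_mem_UPos_ae, h.phi_phi_ae_of_mem_UNeg] with u hmem hinv
  exact ⟨fun hA => hA.1, fun hu =>
    ⟨hu, (hmem hu).2, hinv hu, weight_phi (Or.inr ⟨hu, hmem hu⟩) (hinv hu)⟩⟩

lemma aemeasurable_phi_UPos (h : DispersedCoupling μ ν π) :
    AEMeasurable (phi π) (lebUnit.restrict (UPos π)) := by
  refine (h.unitDensity_excessPos.aemeasurable_timeChange h.unitDensity_excessNeg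
    h.primitive_excessPos_one).restrict.congr ?_
  filter_upwards [ae_restrict_mem h.measurableSet_UPos] with u hu
  exact (phi_of_mem_UPos hu).symm

lemma aemeasurable_phi_UNeg (h : DispersedCoupling μ ν π) :
    AEMeasurable (phi π) (lebUnit.restrict (UNeg π)) := by
  refine (h.unitDensity_excessNeg.aemeasurable_timeChange h.unitDensity_excessPos
    h.primitive_excessPos_one.symm).restrict.congr ?_
  filter_upwards [ae_restrict_mem h.measurableSet_UNeg] with u hu
  exact (phi_of_mem_UNeg hu).symm

lemma setLIntegral_UNeg (h : DispersedCoupling μ ν π) {H : ℝ → ENNReal}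
    (hH : AEMeasurable H lebUnit) :
    ∫⁻ u in UNeg π, H u ∂lebUnit = ∫⁻ u in UPos π, ENNReal.ofReal (excessPos π u) *
      (H (phi π u) / ENNReal.ofReal (excessNeg π (phi π u))) ∂lebUnit := by
  rw [setLIntegral_congr UNeg_ae_eq, h.unitDensity_excessPos.setLIntegral_eq_timeChange
    h.unitDensity_excessNeg h.primitive_excessPos_one hH, ← setLIntegral_congr UPos_ae_eq]
  exact setLIntegral_congr_fun h.measurableSet_UPos fun u hu => by
    simp only [phi_of_mem_UPos hu]

end DispersedCoupling

end Phi

/-! ### The rearranged coupling -/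

section Rearrangement

variable {μ ν : Measure ℝ} {π M : Measure (ℝ × ℝ)}
  {β β' : ℝ × ℝ × Measure ℝ × Measure ℝ → Measure ℝ} {y y' : ℝ} {η η' : Measure ℝ}

lemma exchWeight_mem_Ioo (hb : (y, y', η, η') ∈ exchDomain) :
    exchWeight y y' η η' ∈ Ioo (0 : ℝ) 1 := by
  obtain ⟨-, -, hlt, -, hlt'⟩ := hb
  simp only at hlt hlt'
  exact ⟨div_pos (by linarith) (by linarith), (div_lt_one (by linarith)).2 (by linarith)⟩

lemma exchWeight_mul (hb : (y, y', η, η') ∈ exchDomain) :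
    exchWeight y y' η η' * (y - mean η) = (1 - exchWeight y y' η η') * (mean η' - y') := by
  obtain ⟨-, -, hlt, -, hlt'⟩ := hb
  simp only at hlt hlt'
  have hden : y - mean η + mean η' - y' ≠ 0 := ne_of_gt (by linarith)
  rw [exchWeight]
  field_simp
  ring

lemma IsExchange.mass_eq (hβ : IsExchange β β') (hb : (y, y', η, η') ∈ exchDomain) (s : Set ℝ) :
    β (y, y', η, η') s
        + ENNReal.ofReal (y - mean η) * (β' (y, y', η, η') s / ENNReal.ofReal (mean η' - y'))
      = η s + ENNReal.ofReal (y - mean η) * (η' s / ENNReal.ofReal (mean η' - y')) := by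
  obtain ⟨hp, -⟩ := exchWeight_mem_Ioo hb
  have hgap : 0 < mean η' - y' := sub_pos.2 hb.2.2.2.2
  have hmix := congrArg (fun m : Measure ℝ => ENNReal.ofReal (exchWeight y y' η η')⁻¹ * m s)
    (hβ.mixture y y' η η' hb)
  have hratio : (exchWeight y y' η η')⁻¹ * (1 - exchWeight y y' η η')
      = (y - mean η) / (mean η' - y') := by
    rw [inv_mul_eq_div, div_eq_div_iff hp.ne' hgap.ne', ← exchWeight_mul hb, mul_comm]
  simp only [Measure.coe_add, Measure.coe_smul, Pi.add_apply, Pi.smul_apply, smul_eq_mul,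
    mul_add, ← mul_assoc, ← ENNReal.ofReal_mul (inv_nonneg.2 hp.le), inv_mul_cancel₀ hp.ne',
    hratio, ENNReal.ofReal_one, one_mul, ENNReal.ofReal_div_of_pos hgap] at hmix
  simpa only [div_eq_mul_inv, mul_comm, mul_left_comm, mul_assoc] using hmix

lemma aemeasurable_comp_of_ae_mem {Ω X Y : Type*} [MeasurableSpace Ω] [MeasurableSpace X]
    [MeasurableSpace Y] [Nonempty Y] {P : Measure Ω} {D : Set X} (hD : MeasurableSet D)
    {f : X → Y} (hf : Measurable fun x : D => f x) {q : Ω → X} (hq : AEMeasurable q P)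
    (hmem : ∀ᵐ ω ∂P, q ω ∈ D) : AEMeasurable (fun ω => f (q ω)) P := by
  obtain ⟨g, hg, hgf⟩ := (MeasurableEmbedding.subtype_coe hD).exists_measurable_extend hf
    fun _ => inferInstance
  refine (hg.comp_aemeasurable hq).congr ?_
  filter_upwards [hmem] with ω hω
  exact congrFun hgf ⟨q ω, hω⟩

lemma mKer_of_notMem {u : ℝ} (hu : u ∉ UPos π) (hu' : u ∉ UNeg π) :
    mKer β β' π u = fibre π u := by
  rw [mKer, if_neg fun hA => hu hA.1, if_neg fun hA => hu' hA.1]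

namespace DispersedCoupling

lemma quadruple_mem_ae (h : DispersedCoupling μ ν π) :
    ∀ᵐ u ∂lebUnit, u ∈ UPos π → quadruple π u ∈ exchDomain := by
  filter_upwards [h.fibre_mem_P1_ae, h.comp_phi_ae_of_mem_UPos h.fibre_mem_P1_ae,
    h.phi_mem_UNeg_ae, h.le_phi_ae_of_mem_UPos] with u hP1 hP1phi hmem hle hu
  exact ⟨hP1, hP1phi hu, hu.2, h.monotoneOn_quant hu.1 (hmem hu).1 (hle hu), (hmem hu).2⟩

lemma quadruple_phi_mem_ae (h : DispersedCoupling μ ν π) :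
    ∀ᵐ u ∂lebUnit, u ∈ UNeg π → quadruple π (phi π u) ∈ exchDomain := by
  filter_upwards [h.comp_phi_ae_of_mem_UNeg h.quadruple_mem_ae, h.phi_mem_UPos_ae]
    with u hquad hmem hu
  exact hquad hu (hmem hu)

lemma quadruple_phi_ae_eq (h : DispersedCoupling μ ν π) :
    ∀ᵐ u ∂lebUnit, u ∈ UNeg π →
      quadruple π (phi π u) = (quant π (phi π u), quant π u, fibre π (phi π u), fibre π u) := by
  filter_upwards [h.phi_phi_ae_of_mem_UNeg] with u hinv hu
  rw [quadruple, hinv hu]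

lemma mKer_ae_eq_left (h : DispersedCoupling μ ν π) :
    ∀ᵐ u ∂lebUnit, u ∈ UPos π → mKer β β' π u = β (quadruple π u) := by
  filter_upwards [h.mem_APos_iff_ae] with u hA hu
  rw [mKer, if_pos (hA.2 hu)]

lemma mKer_ae_eq_right (h : DispersedCoupling μ ν π) :
    ∀ᵐ u ∂lebUnit, u ∈ UNeg π → mKer β β' π u = β' (quadruple π (phi π u)) := by
  filter_upwards [h.mem_ANeg_iff_ae] with u hA hu
  rw [mKer, if_neg fun hpos => Set.disjoint_left.1 disjoint_UPos_UNeg hpos.1 hu,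
    if_pos (hA.2 hu)]

lemma aemeasurable_mKer_UPos (h : DispersedCoupling μ ν π) (hβ : IsExchange β β') :
    AEMeasurable (mKer β β' π) (lebUnit.restrict (UPos π)) := by
  have hφ := h.aemeasurable_phi_UPos
  have hquad : AEMeasurable (quadruple π) (lebUnit.restrict (UPos π)) :=
    h.measurable_quant.aemeasurable.prodMk ((h.measurable_quant.comp_aemeasurable hφ).prodMk
      (h.measurable_fibre.aemeasurable.prodMk (h.measurable_fibre.comp_aemeasurable hφ)))
  refine (aemeasurable_comp_of_ae_mem measurableSet_exchDomain hβ.measurable_left hquad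
    ((ae_restrict_iff' h.measurableSet_UPos).2 h.quadruple_mem_ae)).congr ?_
  filter_upwards [(ae_restrict_iff' h.measurableSet_UPos).2 h.mKer_ae_eq_left] with u hu
  exact hu.symm

lemma aemeasurable_mKer_UNeg (h : DispersedCoupling μ ν π) (hβ : IsExchange β β') :
    AEMeasurable (mKer β β' π) (lebUnit.restrict (UNeg π)) := by
  have hφ := h.aemeasurable_phi_UNeg
  have hquad : AEMeasurable (fun u => quadruple π (phi π u)) (lebUnit.restrict (UNeg π)) := by
    refine ((h.measurable_quant.comp_aemeasurable hφ).prodMk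
      (h.measurable_quant.aemeasurable.prodMk ((h.measurable_fibre.comp_aemeasurable hφ).prodMk
        h.measurable_fibre.aemeasurable))).congr ?_
    filter_upwards [(ae_restrict_iff' h.measurableSet_UNeg).2 h.quadruple_phi_ae_eq] with u hu
    exact hu.symm
  refine (aemeasurable_comp_of_ae_mem measurableSet_exchDomain hβ.measurable_right hquad
    ((ae_restrict_iff' h.measurableSet_UNeg).2 h.quadruple_phi_mem_ae)).congr ?_
  filter_upwards [(ae_restrict_iff' h.measurableSet_UNeg).2 h.mKer_ae_eq_right] with u hu
  exact hu.symm

lemma measurableSet_compl_UPos_union_UNeg (h : DispersedCoupling μ ν π) :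
    MeasurableSet (UPos π ∪ UNeg π)ᶜ :=
  (h.measurableSet_UPos.union h.measurableSet_UNeg).compl

lemma aemeasurable_mKer (h : DispersedCoupling μ ν π) (hβ : IsExchange β β') :
    AEMeasurable (mKer β β' π) lebUnit := by
  rw [← Measure.restrict_univ (μ := lebUnit), ← union_compl_self (UPos π ∪ UNeg π),
    aemeasurable_union_iff, aemeasurable_union_iff]
  refine ⟨⟨h.aemeasurable_mKer_UPos hβ, h.aemeasurable_mKer_UNeg hβ⟩,
    h.measurable_fibre.aemeasurable.congr ?_⟩
  filter_upwards [ae_restrict_mem h.measurableSet_compl_UPos_union_UNeg] with u hu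
  exact (mKer_of_notMem (fun hpos => hu (Or.inl hpos)) fun hneg => hu (Or.inr hneg)).symm

lemma mKer_mem_P1_ae (h : DispersedCoupling μ ν π) (hβ : IsExchange β β') :
    ∀ᵐ u ∂lebUnit, mKer β β' π u ∈ P1 := by
  filter_upwards [h.mKer_ae_eq_left (β := β) (β' := β'), h.mKer_ae_eq_right (β := β) (β' := β'),
    h.quadruple_mem_ae, h.quadruple_phi_mem_ae, h.fibre_mem_P1_ae]
    with u hleft hright hquad hquadphi hP1
  by_cases hpos : u ∈ UPos π
  · exact hleft hpos ▸ hβ.mem_left _ (hquad hpos)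
  by_cases hneg : u ∈ UNeg π
  · exact hright hneg ▸ hβ.mem_right _ (hquadphi hneg)
  · rwa [mKer_of_notMem hpos hneg]

lemma isProbabilityMeasure_mKer_ae (h : DispersedCoupling μ ν π) (hβ : IsExchange β β') :
    ∀ᵐ u ∂lebUnit, IsProbabilityMeasure (mKer β β' π u) :=
  (h.mKer_mem_P1_ae hβ).mono fun _ hu => hu.1

lemma mean_mKer_ae (h : DispersedCoupling μ ν π) (hβ : IsExchange β β') :
    ∀ᵐ u ∂lebUnit, mean (mKer β β' π u) = quant π u := by
  filter_upwards [h.mKer_ae_eq_left (β := β) (β' := β'), h.mKer_ae_eq_right (β := β) (β' := β'),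
    h.quadruple_mem_ae, h.quadruple_phi_mem_ae, h.quadruple_phi_ae_eq,
    ae_restrict_mem measurableSet_Ioo] with u hleft hright hquad hquadphi heq huI
  by_cases hpos : u ∈ UPos π
  · exact hleft hpos ▸ hβ.mean_left _ _ _ _ (hquad hpos)
  by_cases hneg : u ∈ UNeg π
  · rw [hright hneg, heq hneg]
    exact hβ.mean_right _ _ _ _ (heq hneg ▸ hquadphi hneg)
  · rw [mKer_of_notMem hpos hneg]
    exact le_antisymm (not_lt.1 fun hlt => hneg ⟨huI, hlt⟩) (not_lt.1 fun hlt => hpos ⟨huI, hlt⟩)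

lemma stochOrder_fibre_mKer_ae (h : DispersedCoupling μ ν π) (hβ : IsExchange β β') :
    ∀ᵐ u ∂lebUnit, bary π u ≤ quant π u → StochOrder (fibre π u) (mKer β β' π u) := by
  filter_upwards [h.mKer_ae_eq_left (β := β) (β' := β'), h.quadruple_mem_ae]
    with u hleft hquad hle
  by_cases hpos : u ∈ UPos π
  · exact hleft hpos ▸ hβ.order_left _ _ _ _ (hquad hpos)
  · rw [mKer_of_notMem hpos fun hneg => hneg.2.not_ge hle]
    exact fun _ _ => le_rfl

lemma stochOrder_mKer_fibre_ae (h : DispersedCoupling μ ν π) (hβ : IsExchange β β') :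
    ∀ᵐ u ∂lebUnit, quant π u ≤ bary π u → StochOrder (mKer β β' π u) (fibre π u) := by
  filter_upwards [h.mKer_ae_eq_right (β := β) (β' := β'), h.quadruple_phi_mem_ae,
    h.quadruple_phi_ae_eq] with u hright hquad heq hle
  by_cases hneg : u ∈ UNeg π
  · rw [hright hneg, heq hneg]
    exact hβ.order_right _ _ _ _ (heq hneg ▸ hquad hneg)
  · rw [mKer_of_notMem (fun hpos => hpos.2.not_ge hle) hneg]
    exact fun _ _ => le_rfl

lemma lintegral_eq_setLIntegral_UPos_add (h : DispersedCoupling μ ν π) {H : ℝ → ENNReal}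
    (hH : AEMeasurable H lebUnit) :
    ∫⁻ u, H u ∂lebUnit
      = (∫⁻ u in UPos π, (H u + ENNReal.ofReal (excessPos π u) *
          (H (phi π u) / ENNReal.ofReal (excessNeg π (phi π u)))) ∂lebUnit)
        + ∫⁻ u in (UPos π ∪ UNeg π)ᶜ, H u ∂lebUnit := by
  rw [lintegral_add_left' hH.restrict, ← h.setLIntegral_UNeg hH,
    ← lintegral_union h.measurableSet_UNeg disjoint_UPos_UNeg,
    lintegral_add_compl _ (h.measurableSet_UPos.union h.measurableSet_UNeg)]

lemma lintegral_mKer (h : DispersedCoupling μ ν π) (hβ : IsExchange β β') {s : Set ℝ}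
    (hs : MeasurableSet s) :
    ∫⁻ u, mKer β β' π u s ∂lebUnit = ∫⁻ u, fibre π u s ∂lebUnit := by
  rw [h.lintegral_eq_setLIntegral_UPos_add (H := fun u => mKer β β' π u s)
      ((Measure.measurable_coe hs).comp_aemeasurable (h.aemeasurable_mKer hβ)),
    h.lintegral_eq_setLIntegral_UPos_add (H := fun u => fibre π u s)
      ((Measure.measurable_coe hs).comp h.measurable_fibre).aemeasurable]
  congr 1
  · refine setLIntegral_congr_fun_ae h.measurableSet_UPos ?_
    filter_upwards [h.mKer_ae_eq_left (β := β) (β' := β'),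
      h.comp_phi_ae_of_mem_UPos (h.mKer_ae_eq_right (β := β) (β' := β')), h.quadruple_mem_ae,
      h.phi_mem_UNeg_ae, h.phi_phi_ae_of_mem_UPos] with u hleft hright hquad hmem hinv hu
    rw [hleft hu, hright hu (hmem hu), hinv hu, excessPos_of_mem_UPos hu,
      excessNeg_of_mem_UNeg (hmem hu)]
    exact hβ.mass_eq (hquad hu) s
  · refine setLIntegral_congr_fun h.measurableSet_compl_UPos_union_UNeg fun u hu => ?_
    rw [mKer_of_notMem (fun hpos => hu (Or.inl hpos)) fun hneg => hu (Or.inr hneg)]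

lemma assemble_fibre (h : DispersedCoupling μ ν π) :
    assemble lebUnit (quant π) (fibre π) = π :=
  have := h.isProbabilityMeasure
  assemble_disint h.measurable_quant (h.map_quant.trans h.mem.1.symm)

lemma rearrangement_mem_couplings (h : DispersedCoupling μ ν π) (hβ : IsExchange β β') :
    rearrangement β β' π ∈ couplings μ ν := by
  have hm := h.aemeasurable_mKer hβ
  have hprob := h.isProbabilityMeasure_mKer_ae hβ
  refine ⟨(fst_assemble h.measurable_quant hm hprob).trans h.map_quant, ?_⟩
  ext s hs
  calc (rearrangement β β' π).snd s = ∫⁻ u, mKer β β' π u s ∂lebUnit :=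
        snd_assemble_apply h.measurable_quant hm hprob hs
    _ = ∫⁻ u, fibre π u s ∂lebUnit := h.lintegral_mKer hβ hs
    _ = (assemble lebUnit (quant π) (fibre π)).snd s :=
        (snd_assemble_apply h.measurable_quant h.measurable_fibre.aemeasurable
          (Filter.Eventually.of_forall h.isProbabilityMeasure_fibre) hs).symm
    _ = ν s := by rw [h.assemble_fibre, h.mem.2]

lemma rearrangement_mem_martCouplings (h : DispersedCoupling μ ν π) (hβ : IsExchange β β') :
    rearrangement β β' π ∈ martCouplings μ ν := by
  have hmem := h.rearrangement_mem_couplings hβ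
  have hmean := mean_disint_assemble_ae h.measurable_quant (h.aemeasurable_mKer hβ)
    (h.isProbabilityMeasure_mKer_ae hβ) (h.mean_mKer_ae hβ)
    (h.map_quant.symm ▸ h.left_mem.2) (integrable_snd_of_mem_couplings h.right_mem.2 hmem)
  rw [h.map_quant] at hmean
  exact ⟨hmem, hmean⟩

lemma disint_rearrangement_Iic_le_ae (h : DispersedCoupling μ ν π) (hβ : IsExchange β β') (t : ℝ) :
    ∀ᵐ x ∂μ, mean (disint π x) ≤ x →
      disint (rearrangement β β' π) x (Iic t) ≤ disint π x (Iic t) := by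
  have := h.isProbabilityMeasure
  have hle : ∀ᵐ u ∂lebUnit, quant π u ∈ {x | mean (disint π x) ≤ x} →
      mKer β β' π u (Iic t) ≤ fibre π u (Iic t) := by
    filter_upwards [h.stochOrder_fibre_mKer_ae hβ, h.isProbabilityMeasure_mKer_ae hβ]
      with u hord hprob hu
    have := h.isProbabilityMeasure_fibre u
    exact (hord hu).measure_Iic_le t
  have hdisint := disint_assemble_le_ae h.measurable_quant (h.aemeasurable_mKer hβ)
    (h.isProbabilityMeasure_mKer_ae hβ) h.measurable_fibre.aemeasurable
    (Filter.Eventually.of_forall h.isProbabilityMeasure_fibre)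
    (measurableSet_le measurable_mean_disint measurable_id) measurableSet_Iic hle
  rwa [h.assemble_fibre, h.map_quant] at hdisint

lemma disint_Iic_le_rearrangement_ae (h : DispersedCoupling μ ν π) (hβ : IsExchange β β') (t : ℝ) :
    ∀ᵐ x ∂μ, x ≤ mean (disint π x) →
      disint π x (Iic t) ≤ disint (rearrangement β β' π) x (Iic t) := by
  have := h.isProbabilityMeasure
  have hle : ∀ᵐ u ∂lebUnit, quant π u ∈ {x | x ≤ mean (disint π x)} →
      fibre π u (Iic t) ≤ mKer β β' π u (Iic t) := by
    filter_upwards [h.stochOrder_mKer_fibre_ae hβ, h.isProbabilityMeasure_mKer_ae hβ]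
      with u hord hprob hu
    have := h.isProbabilityMeasure_fibre u
    exact (hord hu).measure_Iic_le t
  have hdisint := disint_assemble_le_ae h.measurable_quant h.measurable_fibre.aemeasurable
    (Filter.Eventually.of_forall h.isProbabilityMeasure_fibre) (h.aemeasurable_mKer hβ)
    (h.isProbabilityMeasure_mKer_ae hβ)
    (measurableSet_le measurable_id measurable_mean_disint) measurableSet_Iic hle
  rwa [h.assemble_fibre, h.map_quant] at hdisint

lemma stochOrder_disint_ae (h : DispersedCoupling μ ν π) (hβ : IsExchange β β') :
    ∀ᵐ x ∂μ, StochOrder (disint π x) (disint (rearrangement β β' π) x) ∨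
      StochOrder (disint (rearrangement β β' π) x) (disint π x) := by
  have := h.left_mem.1
  have := h.isProbabilityMeasure
  have := isProbabilityMeasure_of_mem_couplings (h.rearrangement_mem_couplings hβ)
  filter_upwards [ae_all_iff.2 fun t : ℚ => h.disint_rearrangement_Iic_le_ae hβ t,
    ae_all_iff.2 fun t : ℚ => h.disint_Iic_le_rearrangement_ae hβ t] with x hdown hup
  exact (le_total (mean (disint π x)) x).imp
    (fun hle => stochOrder_of_forall_rat_measure_Iic_le fun t => hdown t hle)
    (fun hle => stochOrder_of_forall_rat_measure_Iic_le fun t => hup t hle)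

end DispersedCoupling

/-! ### Optimality -/

lemma lintegral_W1_le_of_stochOrder [IsFiniteMeasure π] [IsFiniteMeasure M]
    (hfst : M.fst = π.fst) (hπ : Integrable (fun z : ℝ × ℝ => z.2) π)
    (hM : Integrable (fun z : ℝ × ℝ => z.2) M) (hmart : ∀ᵐ x ∂M.fst, mean (disint M x) = x)
    (hord : ∀ᵐ x ∂π.fst,
      StochOrder (disint π x) (disint M x) ∨ StochOrder (disint M x) (disint π x)) :
    ∫⁻ x, W1 (disint π x) (disint M x) ∂π.fst
      ≤ ∫⁻ x, ENNReal.ofReal |mean (disint π x) - x| ∂π.fst := by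
  refine lintegral_mono_ae ?_
  filter_upwards [disint_mem_P1_ae hπ, hfst ▸ disint_mem_P1_ae hM, hfst ▸ hmart, hord]
    with x hx hx' hmean hord
  rcases hord with hord | hord
  · exact (hord.W1_le hx hx').trans_eq (by rw [hmean])
  · exact (W1_comm _ _).trans_le ((hord.W1_le hx' hx).trans_eq (by rw [hmean, abs_sub_comm]))

lemma AW1_le_lintegral_W1 (hfst : M.fst = π.fst) :
    AW1 π M ≤ ∫⁻ x, W1 (disint π x) (disint M x) ∂π.fst := by
  have hdiag : Measurable fun x : ℝ => (x, x) := measurable_id.prodMk measurable_id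
  have hmem : π.fst.map (fun x => (x, x)) ∈ couplings π.fst M.fst :=
    ⟨(Measure.map_map measurable_fst hdiag).trans Measure.map_id,
      (Measure.map_map measurable_snd hdiag).trans (Measure.map_id.trans hfst.symm)⟩
  refine (iInf₂_le _ hmem).trans ((lintegral_map_le _ _).trans_eq ?_)
  simp only [sub_self, abs_zero, ENNReal.ofReal_zero, zero_add]

lemma lintegral_abs_mean_disint_sub_le_AW1 [IsFiniteMeasure π] [IsFiniteMeasure M]
    (hπ : Integrable (fun z : ℝ × ℝ => z.2) π) (hM : Integrable (fun z : ℝ × ℝ => z.2) M)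
    (hmart : ∀ᵐ x ∂M.fst, mean (disint M x) = x) :
    ∫⁻ x, ENNReal.ofReal |mean (disint π x) - x| ∂π.fst ≤ AW1 π M := by
  refine le_iInf₂ fun χ hχ => ?_
  have hmeas : Measurable fun x => ENNReal.ofReal |mean (disint π x) - x| :=
    ((measurable_mean_disint.sub measurable_id).abs).ennreal_ofReal
  have hπ1 := hχ.1.symm ▸ disint_mem_P1_ae hπ
  have hM1 := hχ.2.symm ▸ disint_mem_P1_ae hM
  have hmart' := hχ.2.symm ▸ hmart
  conv_lhs => rw [← hχ.1, Measure.fst, lintegral_map hmeas measurable_fst]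
  refine lintegral_mono_ae ?_
  filter_upwards [ae_of_ae_map measurable_fst.aemeasurable hπ1,
    ae_of_ae_map measurable_snd.aemeasurable hM1,
    ae_of_ae_map measurable_snd.aemeasurable hmart'] with z hz hz' hmean
  have hW1 := ofReal_abs_mean_sub_le_W1 hz.2 hz'.2
  rw [hmean] at hW1
  refine le_trans ?_ (add_le_add_right hW1 _)
  rw [← ENNReal.ofReal_add (abs_nonneg _) (abs_nonneg _), abs_sub_comm z.1, add_comm]
  exact ENNReal.ofReal_le_ofReal (abs_sub_le _ _ _)

theorem DispersedCoupling.rearrangementIdentities (h : DispersedCoupling μ ν π)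
    (hβ : IsExchange β β') : RearrangementIdentities μ ν π (rearrangement β β' π) := by
  have := h.left_mem.1
  have := h.isProbabilityMeasure
  have hmart := h.rearrangement_mem_martCouplings hβ
  have hfst : (rearrangement β β' π).fst = π.fst := hmart.1.1.trans h.mem.1.symm
  have hlower : ∀ M ∈ martCouplings μ ν,
      ∫⁻ x, ENNReal.ofReal |mean (disint π x) - x| ∂μ ≤ AW1 π M := fun M hM => by
    have := isProbabilityMeasure_of_mem_couplings hM.1
    exact h.mem.1 ▸ lintegral_abs_mean_disint_sub_le_AW1 h.integrable_snd
      (integrable_snd_of_mem_couplings h.right_mem.2 hM.1) (hM.1.1.symm ▸ hM.2)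
  have hupper := AW1_le_lintegral_W1 hfst
  have hW1 : ∫⁻ x, W1 (disint π x) (disint (rearrangement β β' π) x) ∂π.fst
      ≤ ∫⁻ x, ENNReal.ofReal |mean (disint π x) - x| ∂π.fst := by
    have := isProbabilityMeasure_of_mem_couplings hmart.1
    exact lintegral_W1_le_of_stochOrder hfst h.integrable_snd
      (integrable_snd_of_mem_couplings h.right_mem.2 hmart.1) (hmart.1.1.symm ▸ hmart.2)
      (h.mem.1.symm ▸ h.stochOrder_disint_ae hβ)
  rw [h.mem.1] at hupper hW1
  have hinf := le_iInf₂ hlower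
  refine ⟨⟨hmart, le_antisymm ((hupper.trans hW1).trans hinf) (iInf₂_le _ hmart)⟩,
    le_antisymm hupper (hW1.trans (hlower _ hmart)),
    le_antisymm hW1 ((hlower _ hmart).trans hupper), ?_⟩
  simp only [abs_sub_comm _ (_ : ℝ)]
  exact h.integrable_excess.abs.lintegral_lt_top

end Rearrangement

/-! ### The explicit exchange of mass -/

section MonotonePrimitive

variable {F : ℝ → ℝ} {a b : ℝ}

lemma intervalIntegral_ite {f g : ℝ → ℝ} {r : ℝ} (hr : r ∈ Icc (0 : ℝ) 1)
    (hi : IntegrableOn (fun u => if u < r then f u else g u) (Ioo 0 1)) :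
    ∫ u in (0 : ℝ)..1, (if u < r then f u else g u)
      = (∫ u in (0 : ℝ)..r, f u) + ∫ u in r..1, g u := by
  rw [← intervalIntegral.integral_add_adjacent_intervals
    (intervalIntegrable_of_mem_Icc hi (left_mem_Icc.2 zero_le_one) hr)
    (intervalIntegrable_of_mem_Icc hi hr (right_mem_Icc.2 zero_le_one))]
  congr 1
  · rw [intervalIntegral.integral_of_le hr.1, intervalIntegral.integral_of_le hr.1,
      integral_Ioc_eq_integral_Ioo, integral_Ioc_eq_integral_Ioo]
    exact setIntegral_congr_fun measurableSet_Ioo fun u hu => if_pos hu.2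
  · rw [intervalIntegral.integral_of_le hr.2, intervalIntegral.integral_of_le hr.2]
    exact setIntegral_congr_fun measurableSet_Ioc fun u hu => if_neg (not_lt.2 hu.1.le)

lemma primitive_sub_primitive (hi : IntegrableOn F (Ioo 0 1)) (ha : a ∈ Icc (0 : ℝ) 1)
    (hb : b ∈ Icc (0 : ℝ) 1) : primitive F b - primitive F a = ∫ u in a..b, F u :=
  intervalIntegral.integral_interval_sub_left
    (intervalIntegrable_of_mem_Icc hi (left_mem_Icc.2 zero_le_one) hb)
    (intervalIntegrable_of_mem_Icc hi (left_mem_Icc.2 zero_le_one) ha)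

lemma primitive_sub_le_of_monotoneOn (hF : MonotoneOn F (Ioo 0 1))
    (hi : IntegrableOn F (Ioo 0 1)) (ha : 0 ≤ a) (hab : a ≤ b) (hb : b ∈ Ioo (0 : ℝ) 1) :
    primitive F b - primitive F a ≤ (b - a) * F b := by
  have haI : a ∈ Icc (0 : ℝ) 1 := ⟨ha, hab.trans hb.2.le⟩
  have hbI := Ioo_subset_Icc_self hb
  rw [primitive_sub_primitive hi haI hbI, ← smul_eq_mul, ← intervalIntegral.integral_const]
  exact intervalIntegral.integral_mono_on_of_le_Ioo hab
    (intervalIntegrable_of_mem_Icc hi haI hbI) intervalIntegrable_const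
    fun u hu => hF ⟨ha.trans_lt hu.1, hu.2.trans hb.2⟩ hb hu.2.le

lemma le_primitive_sub_of_monotoneOn (hF : MonotoneOn F (Ioo 0 1))
    (hi : IntegrableOn F (Ioo 0 1)) (ha : a ∈ Ioo (0 : ℝ) 1) (hab : a ≤ b) (hb : b ≤ 1) :
    (b - a) * F a ≤ primitive F b - primitive F a := by
  have haI := Ioo_subset_Icc_self ha
  have hbI : b ∈ Icc (0 : ℝ) 1 := ⟨ha.1.le.trans hab, hb⟩
  rw [primitive_sub_primitive hi haI hbI, ← smul_eq_mul, ← intervalIntegral.integral_const]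
  exact intervalIntegral.integral_mono_on_of_le_Ioo hab intervalIntegrable_const
    (intervalIntegrable_of_mem_Icc hi haI hbI)
    fun u hu => hF ha ⟨ha.1.trans hu.1, hu.2.trans_le hb⟩ hu.1.le

lemma convexOn_primitive (hF : MonotoneOn F (Ioo 0 1)) (hi : IntegrableOn F (Ioo 0 1)) :
    ConvexOn ℝ (Icc 0 1) (primitive F) := by
  refine convexOn_of_slope_mono_adjacent (convex_Icc 0 1) fun {x v z} hx hz hxv hvz => ?_
  have hv : v ∈ Ioo (0 : ℝ) 1 := ⟨hx.1.trans_lt hxv, hvz.trans_le hz.2⟩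
  calc (primitive F v - primitive F x) / (v - x) ≤ F v :=
        (div_le_iff₀' (sub_pos.2 hxv)).2 (primitive_sub_le_of_monotoneOn hF hi hx.1 hxv.le hv)
    _ ≤ (primitive F z - primitive F v) / (z - v) :=
        (le_div_iff₀' (sub_pos.2 hvz)).2 (le_primitive_sub_of_monotoneOn hF hi hv hvz.le hz.2)

lemma primitive_le_of_monotoneOn (hF : MonotoneOn F (Ioo 0 1)) (hi : IntegrableOn F (Ioo 0 1))
    (ha : a ∈ Icc (0 : ℝ) 1) : primitive F a ≤ a * primitive F 1 := by
  have hconv := (convexOn_primitive hF hi).2 (left_mem_Icc.2 zero_le_one)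
    (right_mem_Icc.2 zero_le_one) (sub_nonneg.2 ha.2) ha.1 (sub_add_cancel 1 a)
  simpa only [smul_eq_mul, mul_zero, zero_add, mul_one, primitive, intervalIntegral.integral_same]
    using hconv

end MonotonePrimitive

section Exchange

/-- The masses that can be exchanged between two measures weighted by `p` and `1 - p`. -/
abbrev exchRange (p : ℝ) : Set ℝ := Icc 0 (min p (1 - p))

/-- The function of the definition of `exchLeft`, for an arbitrary weight `p` and exchanged
mass `q`. -/
def exchFunLeft (p q : ℝ) (η η' : Measure ℝ) (u : ℝ) : ℝ :=
  if u < q / p then quantile η' ((1 - p * u - p) / (1 - p)) else quantile η u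

/-- The function of the definition of `exchRight`, for an arbitrary weight `p` and exchanged
mass `q`. -/
def exchFunRight (p q : ℝ) (η η' : Measure ℝ) (u : ℝ) : ℝ :=
  if u < q / (1 - p) then quantile η ((1 - p) * u / p) else quantile η' (u - q / (1 - p))

/-- The measure `η` of weight `p` after its lowest mass `q` has been exchanged for the highest
mass `q` of the measure `η'` of weight `1 - p`. -/
def exchLawLeft (p q : ℝ) (η η' : Measure ℝ) : Measure ℝ :=
  (volume.restrict (Icc (0 : ℝ) 1)).map (exchFunLeft p q η η')

/-- The measure `η'` of weight `1 - p` after the same exchange. -/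
def exchLawRight (p q : ℝ) (η η' : Measure ℝ) : Measure ℝ :=
  (volume.restrict (Icc (0 : ℝ) 1)).map (exchFunRight p q η η')

variable {p q : ℝ} {η η' : Measure ℝ}

lemma div_mem_Icc (hp : p ∈ Ioo (0 : ℝ) 1) (hq : q ∈ exchRange p) : q / p ∈ Icc (0 : ℝ) 1 :=
  ⟨div_nonneg hq.1 hp.1.le, (div_le_one hp.1).2 (le_min_iff.1 hq.2).1⟩

lemma div_one_sub_mem_Icc (hp : p ∈ Ioo (0 : ℝ) 1) (hq : q ∈ exchRange p) :
    q / (1 - p) ∈ Icc (0 : ℝ) 1 :=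
  ⟨div_nonneg hq.1 (sub_pos.2 hp.2).le, (div_le_one (sub_pos.2 hp.2)).2 (le_min_iff.1 hq.2).2⟩

lemma one_sub_sub_div_mem_Icc (hp : p ∈ Ioo (0 : ℝ) 1) (hq : q ∈ exchRange p) :
    (1 - q - p) / (1 - p) ∈ Icc (0 : ℝ) 1 :=
  ⟨div_nonneg (by linarith [(le_min_iff.1 hq.2).2]) (sub_pos.2 hp.2).le,
    (div_le_one (sub_pos.2 hp.2)).2 (by linarith [hq.1])⟩

section ChangeOfVariables

variable {f g : ℝ → ℝ}

lemma integral_comp_upper_mass (hp : p ∈ Ioo (0 : ℝ) 1) (hq : q ∈ exchRange p)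
    (hg : IntegrableOn g (Ioo 0 1)) :
    ∫ u in (0 : ℝ)..(q / p), g ((1 - p * u - p) / (1 - p))
      = (1 - p) / p * (primitive g 1 - primitive g ((1 - q - p) / (1 - p))) := by
  have hp0 : p ≠ 0 := hp.1.ne'
  have hp1 : 1 - p ≠ 0 := (sub_pos.2 hp.2).ne'
  have harg (u : ℝ) : (1 - p * u - p) / (1 - p) = 1 - p / (1 - p) * u := by
    field_simp
    ring
  have hend : 1 - p / (1 - p) * (q / p) = (1 - q - p) / (1 - p) := by
    field_simp
    ring
  simp only [harg]
  rw [intervalIntegral.integral_comp_sub_mul g (div_ne_zero hp0 hp1), hend, mul_zero, sub_zero,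
    inv_div, smul_eq_mul, primitive_sub_primitive hg (one_sub_sub_div_mem_Icc hp hq)
      (right_mem_Icc.2 zero_le_one)]

lemma integral_comp_lower_mass (hp : p ∈ Ioo (0 : ℝ) 1) :
    ∫ u in (0 : ℝ)..(q / (1 - p)), f ((1 - p) * u / p)
      = p / (1 - p) * primitive f (q / p) := by
  have hp0 : p ≠ 0 := hp.1.ne'
  have hp1 : 1 - p ≠ 0 := (sub_pos.2 hp.2).ne'
  have hend : (1 - p) / p * (q / (1 - p)) = q / p := by field_simp
  simp only [mul_div_right_comm]
  rw [intervalIntegral.integral_comp_mul_left f (div_ne_zero hp1 hp0), hend, mul_zero, inv_div,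
    smul_eq_mul]

lemma exchange_integral_left (hp : p ∈ Ioo (0 : ℝ) 1) (hq : q ∈ exchRange p)
    (hf : IntegrableOn f (Ioo 0 1)) (hg : IntegrableOn g (Ioo 0 1)) :
    (∫ u in (0 : ℝ)..(q / p), g ((1 - p * u - p) / (1 - p))) + ∫ u in (q / p)..1, f u
      = primitive f 1 - primitive f (q / p)
        + (1 - p) / p * (primitive g 1 - primitive g ((1 - q - p) / (1 - p))) := by
  rw [integral_comp_upper_mass hp hq hg, primitive_sub_primitive hf (div_mem_Icc hp hq)
    (right_mem_Icc.2 zero_le_one), add_comm]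

lemma exchange_integral_add (hp : p ∈ Ioo (0 : ℝ) 1) (hq : q ∈ exchRange p)
    (hf : IntegrableOn f (Ioo 0 1)) (hg : IntegrableOn g (Ioo 0 1)) :
    p * ((∫ u in (0 : ℝ)..(q / p), g ((1 - p * u - p) / (1 - p))) + ∫ u in (q / p)..1, f u)
      + (1 - p) * ((∫ u in (0 : ℝ)..(q / (1 - p)), f ((1 - p) * u / p))
        + ∫ u in (0 : ℝ)..((1 - q - p) / (1 - p)), g u)
      = p * primitive f 1 + (1 - p) * primitive g 1 := by
  have hp0 : p ≠ 0 := hp.1.ne'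
  have hp1 : 1 - p ≠ 0 := (sub_pos.2 hp.2).ne'
  rw [exchange_integral_left hp hq hf hg, integral_comp_lower_mass hp]
  field_simp
  ring

end ChangeOfVariables

section Measurability

variable {Ω : Type*} [MeasurableSpace Ω] {P Q : Ω → ℝ} {κ κ' : Ω → Measure ℝ}

lemma measurable_exchFunLeft_uncurry (hP : Measurable P) (hQ : Measurable Q) (hκ : Measurable κ)
    (hκ' : Measurable κ') (h : ∀ ω, IsProbabilityMeasure (κ ω))
    (h' : ∀ ω, IsProbabilityMeasure (κ' ω)) :
    Measurable fun z : Ω × ℝ => exchFunLeft (P z.1) (Q z.1) (κ z.1) (κ' z.1) z.2 := by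
  have harg : Measurable fun z : Ω × ℝ => (z.1, (1 - P z.1 * z.2 - P z.1) / (1 - P z.1)) := by
    fun_prop
  exact Measurable.ite (measurableSet_lt measurable_snd (by fun_prop))
    ((measurable_quantile_uncurry hκ' h').comp harg) (measurable_quantile_uncurry hκ h)

lemma measurable_exchFunRight_uncurry (hP : Measurable P) (hQ : Measurable Q) (hκ : Measurable κ)
    (hκ' : Measurable κ') (h : ∀ ω, IsProbabilityMeasure (κ ω))
    (h' : ∀ ω, IsProbabilityMeasure (κ' ω)) :
    Measurable fun z : Ω × ℝ => exchFunRight (P z.1) (Q z.1) (κ z.1) (κ' z.1) z.2 := by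
  have harg : Measurable fun z : Ω × ℝ => (z.1, (1 - P z.1) * z.2 / P z.1) := by fun_prop
  have harg' : Measurable fun z : Ω × ℝ => (z.1, z.2 - Q z.1 / (1 - P z.1)) := by fun_prop
  exact Measurable.ite (measurableSet_lt measurable_snd (by fun_prop))
    ((measurable_quantile_uncurry hκ h).comp harg)
    ((measurable_quantile_uncurry hκ' h').comp harg')

lemma measurable_map_of_uncurry {X Y : Type*} [MeasurableSpace X] [MeasurableSpace Y]
    {f : Ω → X → Y} (hf : Measurable fun z : Ω × X => f z.1 z.2) (m : Measure X) [SFinite m] :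
    Measurable fun ω => m.map (f ω) := by
  refine Measure.measurable_of_measurable_coe _ fun s hs => ?_
  have happly (ω : Ω) : m.map (f ω) s = m (Prod.mk ω ⁻¹' ((fun z : Ω × X => f z.1 z.2) ⁻¹' s)) :=
    Measure.map_apply (hf.comp measurable_prodMk_left) hs
  simp only [happly]
  exact measurable_measure_prodMk_left (hf hs)

lemma measurable_exchFunLeft [IsProbabilityMeasure η] [IsProbabilityMeasure η'] :
    Measurable (exchFunLeft p q η η') :=
  Measurable.ite measurableSet_Iio ((measurable_quantile η').comp (by fun_prop))
    (measurable_quantile η)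

lemma measurable_exchFunRight [IsProbabilityMeasure η] [IsProbabilityMeasure η'] :
    Measurable (exchFunRight p q η η') :=
  Measurable.ite measurableSet_Iio ((measurable_quantile η).comp (by fun_prop))
    ((measurable_quantile η').comp (by fun_prop))

end Measurability

lemma exchLawLeft_eq_map_lebUnit : exchLawLeft p q η η' = lebUnit.map (exchFunLeft p q η η') := by
  rw [exchLawLeft, Measure.restrict_congr_set Ioo_ae_eq_Icc.symm]

lemma exchLawRight_eq_map_lebUnit :
    exchLawRight p q η η' = lebUnit.map (exchFunRight p q η η') := by
  rw [exchLawRight, Measure.restrict_congr_set Ioo_ae_eq_Icc.symm]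

instance isProbabilityMeasure_exchLawLeft [IsProbabilityMeasure η] [IsProbabilityMeasure η'] :
    IsProbabilityMeasure (exchLawLeft p q η η') := by
  rw [exchLawLeft_eq_map_lebUnit]
  exact Measure.isProbabilityMeasure_map measurable_exchFunLeft.aemeasurable

instance isProbabilityMeasure_exchLawRight [IsProbabilityMeasure η] [IsProbabilityMeasure η'] :
    IsProbabilityMeasure (exchLawRight p q η η') := by
  rw [exchLawRight_eq_map_lebUnit]
  exact Measure.isProbabilityMeasure_map measurable_exchFunRight.aemeasurable

lemma integral_map_lebUnit {f φ : ℝ → ℝ} (hf : Measurable f) (hφ : Measurable φ) :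
    ∫ x, φ x ∂(lebUnit.map f) = ∫ u in (0 : ℝ)..1, φ (f u) := by
  rw [integral_map hf.aemeasurable hφ.aestronglyMeasurable,
    intervalIntegral.integral_of_le zero_le_one, integral_Ioc_eq_integral_Ioo]

lemma integral_eq_primitive_quantile_one [IsProbabilityMeasure η] {φ : ℝ → ℝ}
    (hφ : Measurable φ) : ∫ x, φ x ∂η = primitive (fun u => φ (quantile η u)) 1 := by
  conv_lhs => rw [← map_quantile η]
  exact integral_map_lebUnit (measurable_quantile η) hφ

lemma integrableOn_comp_quantile [IsProbabilityMeasure η] {φ : ℝ → ℝ} (hi : Integrable φ η) :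
    IntegrableOn (fun u => φ (quantile η u)) (Ioo 0 1) := by
  rw [← map_quantile η] at hi
  exact hi.comp_measurable (measurable_quantile η)

lemma integral_exchLawLeft [IsProbabilityMeasure η] [IsProbabilityMeasure η'] {φ : ℝ → ℝ}
    (hp : p ∈ Ioo (0 : ℝ) 1) (hq : q ∈ exchRange p) (hφ : Measurable φ)
    (hi : Integrable φ (exchLawLeft p q η η')) :
    ∫ x, φ x ∂(exchLawLeft p q η η')
      = (∫ u in (0 : ℝ)..(q / p), φ (quantile η' ((1 - p * u - p) / (1 - p))))
        + ∫ u in (q / p)..1, φ (quantile η u) := by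
  rw [exchLawLeft_eq_map_lebUnit] at hi ⊢
  have hcomp : IntegrableOn (fun u => φ (exchFunLeft p q η η' u)) (Ioo 0 1) :=
    hi.comp_measurable measurable_exchFunLeft
  rw [integral_map_lebUnit measurable_exchFunLeft hφ]
  simp only [exchFunLeft, apply_ite φ] at hcomp ⊢
  exact intervalIntegral_ite (div_mem_Icc hp hq) hcomp

lemma integral_exchLawRight [IsProbabilityMeasure η] [IsProbabilityMeasure η'] {φ : ℝ → ℝ}
    (hp : p ∈ Ioo (0 : ℝ) 1) (hq : q ∈ exchRange p) (hφ : Measurable φ)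
    (hi : Integrable φ (exchLawRight p q η η')) :
    ∫ x, φ x ∂(exchLawRight p q η η')
      = (∫ u in (0 : ℝ)..(q / (1 - p)), φ (quantile η ((1 - p) * u / p)))
        + ∫ u in (0 : ℝ)..((1 - q - p) / (1 - p)), φ (quantile η' u) := by
  rw [exchLawRight_eq_map_lebUnit] at hi ⊢
  have hcomp : IntegrableOn (fun u => φ (exchFunRight p q η η' u)) (Ioo 0 1) :=
    hi.comp_measurable measurable_exchFunRight
  have hp1 : 1 - p ≠ 0 := (sub_pos.2 hp.2).ne'
  have hend : 1 - q / (1 - p) = (1 - q - p) / (1 - p) := by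
    field_simp
    ring
  rw [integral_map_lebUnit measurable_exchFunRight hφ]
  simp only [exchFunRight, apply_ite φ] at hcomp ⊢
  rw [intervalIntegral_ite (div_one_sub_mem_Icc hp hq) hcomp,
    intervalIntegral.integral_comp_sub_right (fun u => φ (quantile η' u)), sub_self, hend]

lemma ofReal_mul_add_ofReal_mul {m m' : Measure ℝ} [IsFiniteMeasure m] [IsFiniteMeasure m']
    {r r' : ℝ} (hr : 0 ≤ r) (hr' : 0 ≤ r') (s : Set ℝ) :
    (ENNReal.ofReal r • m + ENNReal.ofReal r' • m') s
      = ENNReal.ofReal (r * m.real s + r' * m'.real s) := by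
  rw [ENNReal.ofReal_add (mul_nonneg hr measureReal_nonneg) (mul_nonneg hr' measureReal_nonneg),
    ENNReal.ofReal_mul hr, ENNReal.ofReal_mul hr', ofReal_measureReal, ofReal_measureReal]
  rfl

lemma exchLaw_mixture [IsProbabilityMeasure η] [IsProbabilityMeasure η']
    (hp : p ∈ Ioo (0 : ℝ) 1) (hq : q ∈ exchRange p) :
    ENNReal.ofReal p • exchLawLeft p q η η' + ENNReal.ofReal (1 - p) • exchLawRight p q η η'
      = ENNReal.ofReal p • η + ENNReal.ofReal (1 - p) • η' := by
  have hp1 : 0 < 1 - p := sub_pos.2 hp.2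
  ext s hs
  have hφ : Measurable (s.indicator (1 : ℝ → ℝ)) := measurable_one.indicator hs
  have hi (m : Measure ℝ) [IsProbabilityMeasure m] : Integrable (s.indicator (1 : ℝ → ℝ)) m :=
    (integrable_const 1).indicator hs
  rw [ofReal_mul_add_ofReal_mul hp.1.le hp1.le, ofReal_mul_add_ofReal_mul hp.1.le hp1.le]
  simp only [← integral_indicator_one hs]
  rw [integral_exchLawLeft hp hq hφ (hi _), integral_exchLawRight hp hq hφ (hi _),
    exchange_integral_add hp hq (integrableOn_comp_quantile (hi _))
      (integrableOn_comp_quantile (hi _)),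
    ← integral_eq_primitive_quantile_one hφ, ← integral_eq_primitive_quantile_one hφ]

section Mean

variable (hη : η ∈ P1) (hη' : η' ∈ P1) (hp : p ∈ Ioo (0 : ℝ) 1)

include hη hη' hp

lemma integrable_exchLaw_mixture (hq : q ∈ exchRange p) :
    Integrable (fun x : ℝ => x) (ENNReal.ofReal p • exchLawLeft p q η η'
      + ENNReal.ofReal (1 - p) • exchLawRight p q η η') := by
  have := hη.1
  have := hη'.1
  rw [exchLaw_mixture hp hq]
  exact (hη.2.smul_measure ENNReal.ofReal_ne_top).add_measure
    (hη'.2.smul_measure ENNReal.ofReal_ne_top)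

lemma exchLawLeft_mem_P1 (hq : q ∈ exchRange p) : exchLawLeft p q η η' ∈ P1 := by
  have := hη.1
  have := hη'.1
  exact ⟨inferInstance, (integrable_smul_measure (ENNReal.ofReal_pos.2 hp.1).ne'
    ENNReal.ofReal_ne_top).1 (integrable_exchLaw_mixture hη hη' hp hq).left_of_add_measure⟩

lemma exchLawRight_mem_P1 (hq : q ∈ exchRange p) : exchLawRight p q η η' ∈ P1 := by
  have := hη.1
  have := hη'.1
  exact ⟨inferInstance, (integrable_smul_measure (ENNReal.ofReal_pos.2 (sub_pos.2 hp.2)).ne'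
    ENNReal.ofReal_ne_top).1 (integrable_exchLaw_mixture hη hη' hp hq).right_of_add_measure⟩

lemma mean_exchLawLeft (hq : q ∈ exchRange p) : mean (exchLawLeft p q η η') = exchJ p η η' q :=
  have := hη.1
  have := hη'.1
  integral_exchLawLeft hp hq measurable_id (exchLawLeft_mem_P1 hη hη' hp hq).2

lemma mean_exchLawRight (hq : q ∈ exchRange p) :
    mean (exchLawRight p q η η') = exchJ' p η η' q :=
  have := hη.1
  have := hη'.1
  integral_exchLawRight hp hq measurable_id (exchLawRight_mem_P1 hη hη' hp hq).2

lemma exchJ_eq (hq : q ∈ exchRange p) :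
    exchJ p η η' q = mean η - primitive (quantile η) (q / p)
      + (1 - p) / p * (mean η' - primitive (quantile η') ((1 - q - p) / (1 - p))) := by
  have := hη.1
  have := hη'.1
  rw [mean_eq_intervalIntegral_quantile, mean_eq_intervalIntegral_quantile]
  exact exchange_integral_left hp hq (integrableOn_quantile hη) (integrableOn_quantile hη')

lemma mul_exchJ_add (hq : q ∈ exchRange p) :
    p * exchJ p η η' q + (1 - p) * exchJ' p η η' q = p * mean η + (1 - p) * mean η' := by
  have := hη.1
  have := hη'.1
  rw [mean_eq_intervalIntegral_quantile, mean_eq_intervalIntegral_quantile]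
  exact exchange_integral_add hp hq (integrableOn_quantile hη) (integrableOn_quantile hη')

lemma continuousOn_exchJ : ContinuousOn (exchJ p η η') (exchRange p) := by
  have hleft : ContinuousOn (fun q => primitive (quantile η) (q / p)) (exchRange p) :=
    (continuousOn_primitive (integrableOn_quantile hη)).comp (by fun_prop)
      fun _ => div_mem_Icc hp
  have hright : ContinuousOn (fun q => primitive (quantile η') ((1 - q - p) / (1 - p)))
      (exchRange p) :=
    (continuousOn_primitive (integrableOn_quantile hη')).comp (by fun_prop)
      fun _ => one_sub_sub_div_mem_Icc hp
  exact ((continuousOn_const.sub hleft).add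
    (continuousOn_const.mul (continuousOn_const.sub hright))).congr
    fun q hq => exchJ_eq hη hη' hp hq

lemma concaveOn_exchJ : ConcaveOn ℝ (exchRange p) (exchJ p η η') := by
  have := hη.1
  have := hη'.1
  have hleft : ConvexOn ℝ (exchRange p) fun q => primitive (quantile η) (q / p) := by
    refine ⟨convex_Icc _ _, fun s hs t ht a b ha hb hab => ?_⟩
    have hconv := (convexOn_primitive (monotoneOn_quantile η) (integrableOn_quantile hη)).2
      (div_mem_Icc hp hs) (div_mem_Icc hp ht) ha hb hab
    rwa [show a • (s / p) + b • (t / p) = (a • s + b • t) / p by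
      simp only [smul_eq_mul]; ring] at hconv
  have hright : ConvexOn ℝ (exchRange p)
      fun q => primitive (quantile η') ((1 - q - p) / (1 - p)) := by
    refine ⟨convex_Icc _ _, fun s hs t ht a b ha hb hab => ?_⟩
    have hconv := (convexOn_primitive (monotoneOn_quantile η') (integrableOn_quantile hη')).2
      (one_sub_sub_div_mem_Icc hp hs) (one_sub_sub_div_mem_Icc hp ht) ha hb hab
    rwa [show a • ((1 - s - p) / (1 - p)) + b • ((1 - t - p) / (1 - p))
        = (1 - (a • s + b • t) - p) / (1 - p) by
      simp only [smul_eq_mul]; linear_combination hab * (1 - p) / (1 - p)] at hconv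
  have hsum : ConcaveOn ℝ (exchRange p) fun q => mean η - primitive (quantile η) (q / p)
      + (1 - p) / p * (mean η' - primitive (quantile η') ((1 - q - p) / (1 - p))) :=
    ((concaveOn_const _ (convex_Icc _ _)).sub hleft).add
      (((concaveOn_const _ (convex_Icc _ _)).sub hright).smul
        (div_nonneg (sub_pos.2 hp.2).le hp.1.le))
  exact hsum.congr fun q hq => (exchJ_eq hη hη' hp hq).symm

lemma le_mul_exchJ (hq : q ∈ exchRange p) :
    (p - q) * mean η + q * mean η' ≤ p * exchJ p η η' q := by
  have := hη.1
  have := hη'.1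
  have hp0 : 0 < p := hp.1
  have hp1 : 0 < 1 - p := sub_pos.2 hp.2
  have hleft := primitive_le_of_monotoneOn (monotoneOn_quantile η) (integrableOn_quantile hη)
    (div_mem_Icc hp hq)
  have hright := primitive_le_of_monotoneOn (monotoneOn_quantile η') (integrableOn_quantile hη')
    (one_sub_sub_div_mem_Icc hp hq)
  rw [← show mean η = primitive (quantile η) 1 from mean_eq_intervalIntegral_quantile] at hleft
  rw [← show mean η' = primitive (quantile η') 1 from mean_eq_intervalIntegral_quantile] at hright
  rw [exchJ_eq hη hη' hp hq]
  calc (p - q) * mean η + q * mean η'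
      = p * (mean η - q / p * mean η
          + (1 - p) / p * (mean η' - (1 - q - p) / (1 - p) * mean η')) := by
        field_simp
        ring
    _ ≤ _ := by gcongr

lemma mul_exchJ_sub_le {s t : ℝ} (hs : s ∈ Ioo 0 (min p (1 - p))) (ht : t ∈ Icc s (min p (1 - p))) :
    p * (exchJ p η η' t - exchJ p η η' s)
      ≤ (t - s) * (quantile η' ((1 - s - p) / (1 - p)) - quantile η (s / p)) := by
  have := hη.1
  have := hη'.1
  have hp0 : 0 < p := hp.1
  have hp1 : 0 < 1 - p := sub_pos.2 hp.2
  obtain ⟨hsp, hsp'⟩ := lt_min_iff.1 hs.2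
  have htI : t ∈ exchRange p := ⟨hs.1.le.trans ht.1, ht.2⟩
  have hst : s / p ≤ t / p := by gcongr; exact ht.1
  have hts : (1 - t - p) / (1 - p) ≤ (1 - s - p) / (1 - p) := by gcongr; exact ht.1
  have hleft := le_primitive_sub_of_monotoneOn (monotoneOn_quantile η) (integrableOn_quantile hη)
    ⟨div_pos hs.1 hp0, (div_lt_one hp0).2 hsp⟩ hst (div_mem_Icc hp htI).2
  have hright := primitive_sub_le_of_monotoneOn (monotoneOn_quantile η') (integrableOn_quantile hη')
    (one_sub_sub_div_mem_Icc hp htI).1 hts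
    ⟨div_pos (by linarith) hp1, (div_lt_one hp1).2 (by linarith [hs.1])⟩
  have hcancel : p * (t / p - s / p) = t - s := by field_simp
  have hcancel' : (1 - p) * ((1 - s - p) / (1 - p) - (1 - t - p) / (1 - p)) = t - s := by
    field_simp
    ring
  rw [exchJ_eq hη hη' hp htI, exchJ_eq hη hη' hp (Ioo_subset_Icc_self hs)]
  calc p * (mean η - primitive (quantile η) (t / p)
          + (1 - p) / p * (mean η' - primitive (quantile η') ((1 - t - p) / (1 - p)))
        - (mean η - primitive (quantile η) (s / p)
          + (1 - p) / p * (mean η' - primitive (quantile η') ((1 - s - p) / (1 - p)))))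
      = (1 - p) * (primitive (quantile η') ((1 - s - p) / (1 - p))
            - primitive (quantile η') ((1 - t - p) / (1 - p)))
          - p * (primitive (quantile η) (t / p) - primitive (quantile η) (s / p)) := by
        rw [mul_sub, mul_add, mul_add, ← mul_assoc, ← mul_assoc, mul_div_cancel₀ _ hp0.ne']
        ring
    _ ≤ (1 - p) * (((1 - s - p) / (1 - p) - (1 - t - p) / (1 - p))
            * quantile η' ((1 - s - p) / (1 - p)))
          - p * ((t / p - s / p) * quantile η (s / p)) := by gcongr
    _ = (t - s) * (quantile η' ((1 - s - p) / (1 - p)) - quantile η (s / p)) := by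
        rw [← mul_assoc, ← mul_assoc, hcancel, hcancel', mul_sub]

end Mean

variable {y y' : ℝ}

lemma le_exchJ_min (hb : (y, y', η, η') ∈ exchDomain) :
    y ≤ exchJ (exchWeight y y' η η') η η'
      (min (exchWeight y y' η η') (1 - exchWeight y y' η η')) := by
  have hp := exchWeight_mem_Ioo hb
  have hmul := exchWeight_mul hb
  obtain ⟨hη, hη', hy, hyy', hy'⟩ := hb
  simp only at hη hη' hy hyy' hy'
  set p := exchWeight y y' η η'
  have hp1 : 0 < 1 - p := sub_pos.2 hp.2
  have hJ := le_mul_exchJ hη hη' hp (q := min p (1 - p)) ⟨le_min hp.1.le hp1.le, le_rfl⟩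
  refine le_of_mul_le_mul_left (le_trans ?_ hJ) hp.1
  rcases le_total p (1 - p) with hle | hle
  · rw [min_eq_left hle, sub_self, zero_mul, zero_add]
    exact mul_le_mul_of_nonneg_left (hyy'.trans hy'.le) hp.1.le
  · rw [min_eq_right hle]
    linarith [mul_nonneg hp1.le (sub_nonneg.2 (hy.le.trans hyy'))]

lemma exchJ_eq_iff (hb : (y, y', η, η') ∈ exchDomain) (hq : q ∈ exchRange (exchWeight y y' η η')) :
    exchJ (exchWeight y y' η η') η η' q = y ↔ exchJ' (exchWeight y y' η η') η η' q = y' := by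
  have hp := exchWeight_mem_Ioo hb
  have hsum := mul_exchJ_add hb.1 hb.2.1 hp hq
  have hmul := exchWeight_mul hb
  constructor <;> intro hmean <;> rw [hmean] at hsum
  · exact mul_left_cancel₀ (sub_pos.2 hp.2).ne' (by linarith)
  · exact mul_left_cancel₀ hp.1.ne' (by linarith)

lemma exchMass_eq (hb : (y, y', η, η') ∈ exchDomain) :
    exchMass y y' η η' = sInf {q | q ∈ exchRange (exchWeight y y' η η') ∧
      exchJ (exchWeight y y' η η') η η' q = y} := by
  rw [exchMass]
  split_ifs
  · rfl
  · congr 1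
    ext q
    exact and_congr_right fun hq => (exchJ_eq_iff hb hq).symm

lemma exchJ_zero [IsProbabilityMeasure η] : exchJ p η η' 0 = mean η := by
  rw [exchJ, zero_div, intervalIntegral.integral_same, zero_add,
    ← mean_eq_intervalIntegral_quantile]

lemma exists_exchJ_eq (hb : (y, y', η, η') ∈ exchDomain)
    (hq : q ∈ exchRange (exchWeight y y' η η')) (hy : y ≤ exchJ (exchWeight y y' η η') η η' q) :
    ∃ r ∈ Icc 0 q, exchJ (exchWeight y y' η η') η η' r = y := by
  have := hb.1.1
  have hcont := continuousOn_exchJ hb.1 hb.2.1 (exchWeight_mem_Ioo hb)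
  exact intermediate_value_Icc hq.1 (hcont.mono (Icc_subset_Icc_right hq.2))
    ⟨exchJ_zero.trans_le hb.2.2.1.le, hy⟩

lemma min_mem_exchRange (hp : p ∈ Ioo (0 : ℝ) 1) : min p (1 - p) ∈ exchRange p :=
  right_mem_Icc.2 (le_min hp.1.le (sub_pos.2 hp.2).le)

lemma isLeast_exchMass (hb : (y, y', η, η') ∈ exchDomain) :
    IsLeast {q | q ∈ exchRange (exchWeight y y' η η') ∧ exchJ (exchWeight y y' η η') η η' q = y}
      (exchMass y y' η η') := by
  have hp := exchWeight_mem_Ioo hb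
  have hmin := min_mem_exchRange hp
  obtain ⟨r, hr, hJ⟩ := exists_exchJ_eq hb hmin (le_exchJ_min hb)
  have hclosed := (continuousOn_exchJ hb.1 hb.2.1 hp).preimage_isClosed_of_isClosed isClosed_Icc
    (isClosed_singleton (x := y))
  rw [exchMass_eq hb]
  exact hclosed.isLeast_csInf ⟨r, hr, hJ⟩ ⟨0, fun _ hq => hq.1.1⟩

lemma exchMass_mem_exchRange (hb : (y, y', η, η') ∈ exchDomain) :
    exchMass y y' η η' ∈ exchRange (exchWeight y y' η η') :=
  (isLeast_exchMass hb).1.1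

lemma exchJ_exchMass (hb : (y, y', η, η') ∈ exchDomain) :
    exchJ (exchWeight y y' η η') η η' (exchMass y y' η η') = y :=
  (isLeast_exchMass hb).1.2

lemma exchMass_le_iff (hb : (y, y', η, η') ∈ exchDomain)
    (hq : q ∈ exchRange (exchWeight y y' η η')) :
    exchMass y y' η η' ≤ q ↔ y ≤ exchJ (exchWeight y y' η η') η η' q := by
  have hp := exchWeight_mem_Ioo hb
  constructor <;> intro hle
  · refine (le_min (exchJ_exchMass hb).ge (le_exchJ_min hb)).trans
      ((concaveOn_exchJ hb.1 hb.2.1 hp).ge_on_segment (exchMass_mem_exchRange hb)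
        (min_mem_exchRange hp) ?_)
    rw [segment_eq_Icc (hle.trans hq.2)]
    exact ⟨hle, hq.2⟩
  · obtain ⟨r, hr, hJ⟩ := exists_exchJ_eq hb hq hle
    exact ((isLeast_exchMass hb).2 ⟨⟨hr.1, hr.2.trans hq.2⟩, hJ⟩).trans hr.2

lemma quantile_le_quantile_of_lt_exchMass (hb : (y, y', η, η') ∈ exchDomain) {s : ℝ} (hs : 0 < s)
    (hlt : s < exchMass y y' η η') :
    quantile η (s / exchWeight y y' η η')
      ≤ quantile η' ((1 - s - exchWeight y y' η η') / (1 - exchWeight y y' η η')) := by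
  have hp := exchWeight_mem_Ioo hb
  have hm := exchMass_mem_exchRange hb
  have hsI : s ∈ Ioo 0 (min (exchWeight y y' η η') (1 - exchWeight y y' η η')) :=
    ⟨hs, hlt.trans_le hm.2⟩
  have hJ : exchJ (exchWeight y y' η η') η η' s < y :=
    lt_of_not_ge fun hle => hlt.not_ge ((exchMass_le_iff hb (Ioo_subset_Icc_self hsI)).2 hle)
  have hrate := mul_exchJ_sub_le hb.1 hb.2.1 hp hsI ⟨hlt.le, hm.2⟩
  rw [exchJ_exchMass hb] at hrate
  exact sub_nonneg.1 (pos_of_mul_pos_right ((mul_pos hp.1 (sub_pos.2 hJ)).trans_le hrate)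
    (sub_pos.2 hlt).le).le

lemma measurable_exchWeight_subtype :
    Measurable fun b : exchDomain => exchWeight b.1.1 b.1.2.1 b.1.2.2.1 b.1.2.2.2 := by
  have hcoe : Measurable fun b : exchDomain => b.1 := measurable_subtype_coe
  have hη := measurable_mean.comp hcoe.snd.snd.fst
  have hη' := measurable_mean.comp hcoe.snd.snd.snd
  exact (hη'.sub hcoe.snd.fst).div (((hcoe.fst.sub hη).add hη').sub hcoe.snd.fst)

lemma measurable_exchLawLeft {Q : exchDomain → ℝ} (hQ : Measurable Q) :
    Measurable fun b : exchDomain => exchLawLeft (exchWeight b.1.1 b.1.2.1 b.1.2.2.1 b.1.2.2.2)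
      (Q b) b.1.2.2.1 b.1.2.2.2 :=
  measurable_map_of_uncurry (measurable_exchFunLeft_uncurry measurable_exchWeight_subtype hQ
    measurable_subtype_coe.snd.snd.fst measurable_subtype_coe.snd.snd.snd
    (fun b => b.2.1.1) fun b => b.2.2.1.1) _

lemma measurable_exchLawRight {Q : exchDomain → ℝ} (hQ : Measurable Q) :
    Measurable fun b : exchDomain => exchLawRight (exchWeight b.1.1 b.1.2.1 b.1.2.2.1 b.1.2.2.2)
      (Q b) b.1.2.2.1 b.1.2.2.2 :=
  measurable_map_of_uncurry (measurable_exchFunRight_uncurry measurable_exchWeight_subtype hQ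
    measurable_subtype_coe.snd.snd.fst measurable_subtype_coe.snd.snd.snd
    (fun b => b.2.1.1) fun b => b.2.2.1.1) _

lemma measurable_exchMass_subtype :
    Measurable fun b : exchDomain => exchMass b.1.1 b.1.2.1 b.1.2.2.1 b.1.2.2.2 := by
  refine measurable_of_Iic fun r => ?_
  rcases lt_or_ge r 0 with hr | hr
  · convert MeasurableSet.empty
    exact eq_empty_of_forall_notMem fun b hb =>
      hr.not_ge ((exchMass_mem_exchRange b.2).1.trans hb)
  have hP := measurable_exchWeight_subtype
  have hQ : Measurable fun b : exchDomain =>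
      min r (min (exchWeight b.1.1 b.1.2.1 b.1.2.2.1 b.1.2.2.2)
        (1 - exchWeight b.1.1 b.1.2.1 b.1.2.2.1 b.1.2.2.2)) :=
    measurable_const.min (hP.min (measurable_const.sub hP))
  convert measurableSet_le measurable_subtype_coe.fst
    (measurable_mean.comp (measurable_exchLawLeft hQ)) using 1
  ext ⟨⟨y, y', η, η'⟩, hb⟩
  have hp := exchWeight_mem_Ioo hb
  have hq : min r (min (exchWeight y y' η η') (1 - exchWeight y y' η η'))
      ∈ exchRange (exchWeight y y' η η') :=
    ⟨le_min hr (min_mem_exchRange hp).1, min_le_right _ _⟩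
  have hiff := exchMass_le_iff hb hq
  rwa [← mean_exchLawLeft hb.1 hb.2.1 hp hq, le_min_iff,
    and_iff_left (exchMass_mem_exchRange hb).2] at hiff

lemma stochOrder_exchLawLeft (hb : (y, y', η, η') ∈ exchDomain) :
    StochOrder η (exchLawLeft (exchWeight y y' η η') (exchMass y y' η η') η η') := by
  have := hb.1.1
  have := hb.2.1.1
  have hp := exchWeight_mem_Ioo hb
  refine stochOrder_of_forall_rat_measure_Iic_le fun t => ?_
  conv_rhs => rw [← map_quantile η]
  rw [exchLawLeft_eq_map_lebUnit, Measure.map_apply measurable_exchFunLeft measurableSet_Iic,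
    Measure.map_apply (measurable_quantile η) measurableSet_Iic]
  refine measure_mono_ae ?_
  filter_upwards [ae_restrict_mem measurableSet_Ioo] with u hu hut
  refine le_trans ?_ (show exchFunLeft _ _ η η' u ≤ t from hut)
  rw [exchFunLeft]
  split_ifs with hlt
  · have hle := quantile_le_quantile_of_lt_exchMass hb (mul_pos hp.1 hu.1)
      ((lt_div_iff₀' hp.1).1 hlt)
    rwa [mul_div_cancel_left₀ _ hp.1.ne'] at hle
  · exact le_rfl

lemma stochOrder_exchLawRight (hb : (y, y', η, η') ∈ exchDomain) :
    StochOrder (exchLawRight (exchWeight y y' η η') (exchMass y y' η η') η η') η' := by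
  have := hb.1.1
  have := hb.2.1.1
  have hp := exchWeight_mem_Ioo hb
  have hmix := exchLaw_mixture (η := η) (η' := η') hp (exchMass_mem_exchRange hb)
  refine stochOrder_of_forall_rat_measure_Iic_le fun t => ?_
  have hleft := (stochOrder_exchLawLeft hb).measure_Iic_le t
  have hmix_t := congrArg (fun m : Measure ℝ => m (Iic (t : ℝ))) hmix
  simp only [Measure.coe_add, Measure.coe_smul, Pi.add_apply, Pi.smul_apply, smul_eq_mul]
    at hmix_t
  have hright : ENNReal.ofReal (1 - exchWeight y y' η η') * η' (Iic (t : ℝ))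
      ≤ ENNReal.ofReal (1 - exchWeight y y' η η')
        * exchLawRight (exchWeight y y' η η') (exchMass y y' η η') η η' (Iic (t : ℝ)) := by
    refine (ENNReal.add_le_add_iff_left (a := ENNReal.ofReal (exchWeight y y' η η')
      * η (Iic (t : ℝ))) (ENNReal.mul_ne_top ENNReal.ofReal_ne_top (measure_ne_top _ _))).1 ?_
    rw [← hmix_t]
    gcongr
  exact (ENNReal.mul_le_mul_iff_right (ENNReal.ofReal_pos.2 (sub_pos.2 hp.2)).ne'
    ENNReal.ofReal_ne_top).1 hright

theorem isExchange_exchLeft_exchRight : IsExchange exchLeft exchRight where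
  measurable_left := measurable_exchLawLeft measurable_exchMass_subtype
  measurable_right := measurable_exchLawRight measurable_exchMass_subtype
  mem_left _ hb :=
    exchLawLeft_mem_P1 hb.1 hb.2.1 (exchWeight_mem_Ioo hb) (exchMass_mem_exchRange hb)
  mem_right _ hb :=
    exchLawRight_mem_P1 hb.1 hb.2.1 (exchWeight_mem_Ioo hb) (exchMass_mem_exchRange hb)
  mean_left _ _ _ _ hb :=
    (mean_exchLawLeft hb.1 hb.2.1 (exchWeight_mem_Ioo hb) (exchMass_mem_exchRange hb)).trans
      (exchJ_exchMass hb)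
  mean_right _ _ _ _ hb :=
    (mean_exchLawRight hb.1 hb.2.1 (exchWeight_mem_Ioo hb) (exchMass_mem_exchRange hb)).trans
      ((exchJ_eq_iff hb (exchMass_mem_exchRange hb)).1 (exchJ_exchMass hb))
  order_left _ _ _ _ hb := stochOrder_exchLawLeft hb
  order_right _ _ _ _ hb := stochOrder_exchLawRight hb
  mixture _ _ _ _ hb :=
    have := hb.1.1
    have := hb.2.1.1
    exchLaw_mixture (exchWeight_mem_Ioo hb) (exchMass_mem_exchRange hb)

end Exchange

end MartRearr

end

open MeasureTheory MartRearr in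
theorem mainTheorem1 (μ ν : Measure ℝ) (hμ : μ ∈ P1) (hν : ν ∈ P1)
    (hcx : ConvexOrder μ ν) (hne : μ ≠ ν)
    (π : Measure (ℝ × ℝ)) (hπ : π ∈ couplings μ ν) (hdisp : BarycentreDispersion μ π) :
    RearrangementIdentities μ ν π (rearrangement exchLeft exchRight π) ∧
    IsExchange exchLeft exchRight ∧
    ∀ β β' : ℝ × ℝ × Measure ℝ × Measure ℝ → Measure ℝ, IsExchange β β' →
      RearrangementIdentities μ ν π (rearrangement β β' π) := by
  have h : DispersedCoupling μ ν π := ⟨hμ, hν, hcx.mean_eq hμ.2 hν.2, hπ, hdisp⟩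
  exact ⟨h.rearrangementIdentities isExchange_exchLeft_exchRight, isExchange_exchLeft_exchRight,
    fun _ _ hβ => h.rearrangementIdentities hβ⟩
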